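/- Let $\mathbb K$ be a field and let $n>1$. Let $Q$ be a quiver of type $\widetilde{\mathbb A}_n$: it has vertices $x_0,\dots,x_{n-1}$ and edges $e_0,\dots,e_{n-1}$, where $e_j$ joins $x_{j-1}$ and $x_j$ for $1\le j\le n-1$, the edge $e_0$ joins $x_{n-1}$ and $x_0$, and each edge has an arbitrary direction. The unwinding $\mathbf UQ$ has vertices $(x_i,c)$ and edges $(e_j,c)$ with $c\in\mathbb Z$; the edge $(e_j,c)$ joins $(x_{j-1},c)$ and $(x_j,c)$ if $j\neq 0$, the edge $(e_0,c)$ joins $(x_{n-1},c-1)$ and $(x_0,c)$, and $(e_j,c)$ is directed as $e_j$ is. The vertex $(x_i,c)$ is identified with the integer $i+cn$. A representation $W$ of $\mathbf UQ$ over $\mathbb K$ is periodic if $W_{(x_i,c)}=W_{(x_i,c+1)}$ for all vertices and $W_{(e_j,c)}=W_{(e_j,c+1)}$ for all edges. Let $\mathbf{PRep}(\mathbf UQ)$ be the full subcategory of the category of representations of $\mathbf UQ$ whose objects are the periodic representations all of whose vector spaces are finite-dimensional (morphisms need not be periodic). An object is indecomposable if it is nonzero and, whenever it is isomorphic to a direct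 sum of two objects of the category, one of these two is zero. For an interval $S\subseteq\mathbb Z$, the interval representation $\mathbf I[S]$ is $\mathbb K$ at the vertices in $S$ and $0$ at all other vertices; its edge maps are the identity of $\mathbb K$ along edges with both ends in $S$, and zero otherwise. Write $\mathbf I[-\infty,\infty]:=\mathbf I[\mathbb Z]$ and, for integers $u\le v$, $\mathbf I[u,v]:=\mathbf I[\{u,u+1,\dots,v\}]$ and $$\mathbf\Sigma[u,v]:=\bigoplus_{c\in\mathbb Z}\mathbf I[u+cn,\,v+cn].$$ Then each of $\mathbf I[-\infty,\infty]$ and $\mathbf\Sigma[u,v]$ (for integers $u\le v$) is isomorphic to an object of $\mathbf{PRep}(\mathbf UQ)$, and an object $W$ of $\mathbf{PRep}(\mathbf UQ)$ is indecomposable in $\mathbf{PRep}(\mathbf UQ)$ if and only if $W\cong\mathbf I[-\infty,\infty]$ or $W\cong\mathbf\Sigma[u,v]$ for some integers $u\le v$. -/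

import Mathlib

open CategoryTheory CategoryTheory.Limits
open scoped DirectSum

universe u

namespace UnwoundQuiver

/-! ### Quivers and their representations -/

/-- A quiver: a set of vertices, a set of edges, and source and target maps. -/
structure EdgeQuiver where
  /-- the vertices -/
  Vert : Type
  /-- the edges -/
  Edge : Type
  /-- the source of an edge -/
  src : Edge → Vert
  /-- the target of an edge -/
  tgt : Edge → Vert

/-- A representation of a quiver `Γ` over the field `K` (not necessarily finite-dimensional):
a vector space at every vertex and a linear map along every edge. -/
structure Rep (K : Type u) [Field K] (Γ : EdgeQuiver) where
  /-- the vector space at a vertex -/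
  obj : Γ.Vert → ModuleCat.{u} K
  /-- the linear map along an edge -/
  map : ∀ e : Γ.Edge, obj (Γ.src e) ⟶ obj (Γ.tgt e)

namespace Rep

variable {K : Type u} [Field K] {Γ : EdgeQuiver}

/-- A morphism of representations: linear maps at the vertices, commuting with the edge maps. -/
@[ext]
structure Hom (V W : Rep K Γ) where
  /-- the component at a vertex -/
  app : ∀ x : Γ.Vert, V.obj x ⟶ W.obj x
  comm : ∀ e : Γ.Edge, V.map e ≫ app (Γ.tgt e) = app (Γ.src e) ≫ W.map e

/-- The category of all representations of `Γ` over `K`. -/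
instance : Category (Rep K Γ) where
  Hom V W := Hom V W
  id V := ⟨fun x => 𝟙 (V.obj x), fun e => by simp⟩
  comp f g := ⟨fun x => f.app x ≫ g.app x, fun e => by
    rw [← Category.assoc, f.comm, Category.assoc, g.comm, Category.assoc]⟩

@[ext]
theorem hom_ext {V W : Rep K Γ} {f g : V ⟶ W} (h : ∀ x, f.app x = g.app x) : f = g :=
  Hom.ext (funext h)

@[simp]
theorem id_app (V : Rep K Γ) (x : Γ.Vert) : Hom.app (𝟙 V) x = 𝟙 (V.obj x) := rfl

@[simp]
theorem comp_app {U V W : Rep K Γ} (f : U ⟶ V) (g : V ⟶ W) (x : Γ.Vert) :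
    Hom.app (f ≫ g) x = f.app x ≫ g.app x := rfl

/-- Morphisms of representations are added vertex by vertex. -/
instance (V W : Rep K Γ) : Add (V ⟶ W) where
  add f g := ⟨fun x => f.app x + g.app x, fun e => by
    rw [Preadditive.comp_add, Preadditive.add_comp, f.comm, g.comm]⟩

instance (V W : Rep K Γ) : Zero (V ⟶ W) where
  zero := ⟨fun _ => 0, fun e => by simp⟩

instance (V W : Rep K Γ) : Neg (V ⟶ W) where
  neg f := ⟨fun x => -f.app x, fun e => by
    rw [Preadditive.comp_neg, Preadditive.neg_comp, f.comm]⟩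

@[simp]
theorem add_app {V W : Rep K Γ} (f g : V ⟶ W) (x : Γ.Vert) :
    Hom.app (f + g) x = f.app x + g.app x := rfl

@[simp]
theorem zero_app (V W : Rep K Γ) (x : Γ.Vert) : Hom.app (0 : V ⟶ W) x = 0 := rfl

@[simp]
theorem neg_app {V W : Rep K Γ} (f : V ⟶ W) (x : Γ.Vert) : Hom.app (-f) x = -f.app x := rfl

instance (V W : Rep K Γ) : AddCommGroup (V ⟶ W) where
  add_assoc f g h := by ext1 x; simp only [add_app, add_assoc]
  zero_add f := by ext1 x; simp only [add_app, zero_app, zero_add]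
  add_zero f := by ext1 x; simp only [add_app, zero_app, add_zero]
  add_comm f g := by ext1 x; simp only [add_app, add_comm]
  neg_add_cancel f := by ext1 x; simp only [add_app, neg_app, zero_app, neg_add_cancel]
  nsmul := nsmulRec
  zsmul := zsmulRec

instance : Preadditive (Rep K Γ) where
  add_comp U V W f g h := by
    ext1 x; simp only [add_app, comp_app, Preadditive.add_comp]
  comp_add U V W f g h := by
    ext1 x; simp only [add_app, comp_app, Preadditive.comp_add]

/-- The direct sum of a family of representations, formed vertex by vertex and edge by edge. -/
noncomputable def directSum {ι : Type} (F : ι → Rep K Γ) : Rep K Γ where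
  obj x := ModuleCat.of K (⨁ i, (F i).obj x)
  map e := ModuleCat.ofHom (DirectSum.lmap fun i => ((F i).map e).hom)

/-- The direct sum of two representations, formed vertex by vertex and edge by edge. -/
def prod (V W : Rep K Γ) : Rep K Γ where
  obj x := ModuleCat.of K (V.obj x × W.obj x)
  map e := ModuleCat.ofHom ((V.map e).hom.prodMap (W.map e).hom)

/-- All the vector spaces of the representation are finite-dimensional. -/
def IsPointwiseFinite (V : Rep K Γ) : Prop :=
  ∀ x : Γ.Vert, FiniteDimensional K (V.obj x)

end Rep

/-! ### Affine type `A` quivers and their unwinding -/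

/-- The cyclic predecessor `j - 1` of `j`, where the predecessor of `0` is `n - 1`. -/
def cyclicPred {n : ℕ} (j : Fin n) : Fin n :=
  if j.val = 0 then ⟨n - 1, Nat.sub_lt j.pos Nat.one_pos⟩
  else ⟨j.val - 1, (Nat.sub_le _ _).trans_lt j.isLt⟩

/-- A quiver whose underlying graph is a cycle with vertices `x_0, …, x_{n-1}` and edges
`e_0, …, e_{n-1}`: the edge `e_j` joins `x_{j-1}` and `x_j`, and `e_0` joins `x_{n-1}` and `x_0`.
Each edge may have either of the two directions. -/
structure CyclicQuiver (n : ℕ) where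
  /-- the source of `e_j` -/
  src : Fin n → Fin n
  /-- the target of `e_j` -/
  tgt : Fin n → Fin n
  joins : ∀ j, (src j = cyclicPred j ∧ tgt j = j) ∨ (src j = j ∧ tgt j = cyclicPred j)

variable {n : ℕ}

/-- The source of the edge `(e_j, c)` of the unwinding of `Q`: it is `(s(e_j), c)` if `j ≠ 0`; for
`j = 0` it is `(x_0, c)` if `s(e_0) = x_0`, and `(x_{n-1}, c - 1)` if `s(e_0) = x_{n-1}`. -/
def unwoundSrc (Q : CyclicQuiver n) (e : Fin n × ℤ) : Fin n × ℤ :=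
  if e.1.val = 0 then
    if Q.src e.1 = e.1 then (Q.src e.1, e.2) else (Q.src e.1, e.2 - 1)
  else (Q.src e.1, e.2)

/-- The target of the edge `(e_j, c)` of the unwinding of `Q`: it is `(t(e_j), c)` if `j ≠ 0`; for
`j = 0` it is `(x_{n-1}, c - 1)` if `s(e_0) = x_0`, and `(x_0, c)` if `s(e_0) = x_{n-1}`. -/
def unwoundTgt (Q : CyclicQuiver n) (e : Fin n × ℤ) : Fin n × ℤ :=
  if e.1.val = 0 then
    if Q.src e.1 = e.1 then (Q.tgt e.1, e.2 - 1) else (Q.tgt e.1, e.2)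
  else (Q.tgt e.1, e.2)

/-- The unwinding of `Q`, with vertices the pairs `(x_i, c)` and edges the pairs `(e_j, c)`,
where `c ∈ ℤ`. -/
abbrev unwinding (Q : CyclicQuiver n) : EdgeQuiver where
  Vert := Fin n × ℤ
  Edge := Fin n × ℤ
  src := unwoundSrc Q
  tgt := unwoundTgt Q

/-- The position `i + c * n` on the integer line of the vertex `(x_i, c)` of the unwinding. -/
def position (x : Fin n × ℤ) : ℤ :=
  (x.1.val : ℤ) + x.2 * (n : ℤ)

variable (K : Type u) [Field K]

/-! ### Interval representations -/

open Classical in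
/-- The interval representation `I[S]` of the unwinding, for an interval `S` of integers: it is `K`
at the vertices whose position lies in `S` and zero at the others, and an edge map is the identity
of `K` if both ends of the edge lie in `S` and is zero otherwise. -/
noncomputable def interval (Q : CyclicQuiver n) (S : Set ℤ) : Rep K (unwinding Q) where
  obj x := if position x ∈ S then ModuleCat.of K K else ModuleCat.of K PUnit
  map e :=
    if h : position (unwoundSrc Q e) ∈ S ∧ position (unwoundTgt Q e) ∈ S then
      eqToHom (by rw [if_pos h.1, if_pos h.2])
    else 0

/-- The orbit sum `Σ[u,v]`, the direct sum over all `c ∈ ℤ` of `I[u + cn, v + cn]`. -/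
noncomputable def orbitSum (Q : CyclicQuiver n) (u v : ℤ) : Rep K (unwinding Q) :=
  Rep.directSum fun c : ℤ => interval K Q (Set.Icc (u + c * (n : ℤ)) (v + c * (n : ℤ)))

/-! ### Periodic representations -/

/-- A representation `W` of the unwinding is periodic if `W_{(x_i,c)} = W_{(x_i,c+1)}` for all
vertices and `W_{(e_j,c)} = W_{(e_j,c+1)}` for all edges. (The second equation is an `HEq`, because
the two linear maps have the same source and target only by the first equation.) -/
def IsPeriodic {K : Type u} [Field K] {Q : CyclicQuiver n} (W : Rep K (unwinding Q)) : Prop :=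
  (∀ (i : Fin n) (c : ℤ), W.obj (i, c) = W.obj (i, c + 1)) ∧
    ∀ (j : Fin n) (c : ℤ), HEq (W.map (j, c)) (W.map (j, c + 1))

/-- The defining property of the objects of `PRep`: pointwise finite-dimensional and periodic. -/
def periodicFinite (Q : CyclicQuiver n) : ObjectProperty (Rep K (unwinding Q)) :=
  fun W => W.IsPointwiseFinite ∧ IsPeriodic W

/-- The category of pointwise finite-dimensional periodic representations of the unwinding of `Q`,
a full subcategory of all representations: the morphisms need not be periodic. -/
abbrev PRep (Q : CyclicQuiver n) :=
  (periodicFinite K Q).FullSubcategory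

/-! ### Direct sums of two periodic representations -/

variable {K} {Q : CyclicQuiver n}

theorem heq_prodMap {A A' B B' C C' D D' : ModuleCat.{u} K} {f : A ⟶ B} {f' : A' ⟶ B'}
    {g : C ⟶ D} {g' : C' ⟶ D'} (hA : A = A') (hB : B = B') (hC : C = C') (hD : D = D')
    (hf : HEq f f') (hg : HEq g g') :
    HEq (ModuleCat.ofHom (f.hom.prodMap g.hom)) (ModuleCat.ofHom (f'.hom.prodMap g'.hom)) := by
  subst hA hB hC hD
  cases hf
  cases hg
  rfl

/-- The source of the edge `(e_j, c + 1)` is the shift of the source of `(e_j, c)`. -/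
theorem src_shift (j : Fin n) (c : ℤ) :
    unwoundSrc Q (j, c + 1) =
      ((unwoundSrc Q (j, c)).1, (unwoundSrc Q (j, c)).2 + 1) := by
  simp only [unwoundSrc]
  split_ifs <;> simp

/-- The target of the edge `(e_j, c + 1)` is the shift of the target of `(e_j, c)`. -/
theorem tgt_shift (j : Fin n) (c : ℤ) :
    unwoundTgt Q (j, c + 1) =
      ((unwoundTgt Q (j, c)).1, (unwoundTgt Q (j, c)).2 + 1) := by
  simp only [unwoundTgt]
  split_ifs <;> simp

theorem IsPeriodic.obj_src {W : Rep K (unwinding Q)} (h : IsPeriodic W) (j : Fin n) (c : ℤ) :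
    W.obj (unwoundSrc Q (j, c)) = W.obj (unwoundSrc Q (j, c + 1)) := by
  rw [src_shift]
  exact h.1 _ _

theorem IsPeriodic.obj_tgt {W : Rep K (unwinding Q)} (h : IsPeriodic W) (j : Fin n) (c : ℤ) :
    W.obj (unwoundTgt Q (j, c)) = W.obj (unwoundTgt Q (j, c + 1)) := by
  rw [tgt_shift]
  exact h.1 _ _

theorem periodicFinite_prod {V W : Rep K (unwinding Q)} (hV : periodicFinite K Q V)
    (hW : periodicFinite K Q W) : periodicFinite K Q (V.prod W) := by
  refine ⟨fun x => ?_, fun i c => ?_, fun j c => ?_⟩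
  · have := hV.1 x
    have := hW.1 x
    exact inferInstanceAs (FiniteDimensional K (V.obj x × W.obj x))
  · change ModuleCat.of K (V.obj (i, c) × W.obj (i, c)) =
      ModuleCat.of K (V.obj (i, c + 1) × W.obj (i, c + 1))
    rw [hV.2.1 i c, hW.2.1 i c]
  · exact heq_prodMap (hV.2.obj_src j c) (hV.2.obj_tgt j c) (hW.2.obj_src j c)
      (hW.2.obj_tgt j c) (hV.2.2 j c) (hW.2.2 j c)

/-- The pointwise direct sum of two objects of `PRep`, with its projections and injections. -/
def prodBicone (V W : PRep K Q) : BinaryBicone V W where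
  pt := ⟨V.obj.prod W.obj, periodicFinite_prod V.property W.property⟩
  fst := ObjectProperty.homMk ⟨fun _ => ModuleCat.ofHom (LinearMap.fst K _ _), fun _ => rfl⟩
  snd := ObjectProperty.homMk ⟨fun _ => ModuleCat.ofHom (LinearMap.snd K _ _), fun _ => rfl⟩
  inl := ObjectProperty.homMk ⟨fun _ => ModuleCat.ofHom (LinearMap.inl K _ _), fun e => by
    ext a; exact Prod.ext rfl (map_zero (W.obj.map e).hom).symm⟩
  inr := ObjectProperty.homMk ⟨fun _ => ModuleCat.ofHom (LinearMap.inr K _ _), fun e => by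
    ext a; exact Prod.ext (map_zero (V.obj.map e).hom).symm rfl⟩
  inl_fst := rfl
  inl_snd := rfl
  inr_fst := rfl
  inr_snd := rfl

/-- `PRep` has direct sums of two objects, so that Mathlib's `Indecomposable` applies to it. -/
instance : HasBinaryBiproducts (PRep K Q) where
  has_binary_biproduct V W := by
    refine hasBinaryBiproduct_of_total (prodBicone V W) ?_
    ext1
    refine Rep.hom_ext fun x => ?_
    refine ModuleCat.hom_ext (LinearMap.ext fun p => ?_)
    obtain ⟨a, b⟩ := p
    exact Prod.ext (add_zero a) (zero_add b)

end UnwoundQuiver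

namespace UnwoundQuiver

/-! ### Vertices and edges on the integer line -/

section Line

variable {n : ℕ} {Q : CyclicQuiver n}

/-! A direct summand I[u,v] of W amounts to morphisms I[u,v] → W → I[u,v], a section w and a
cosection φ, with φ(w) = 1 on [u,v]. The proof turns on whether a periodic W has such a summand with
[u,v] finite.

Suppose it has one. By periodicity all translates of w and φ by multiples of n are available. The
pairing of a section with a cosection is one scalar on the overlap of their intervals. All left ends
u + cn carry translates of one edge, pointing in one direction, and that direction forces the
pairing to vanish when the left ends come in one of the two orders. At each vertex the pairings of
translates therefore form a unitriangular matrix (`eq_zero_of_sections`). Hence the span of the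
translates of w is complementary to the common kernel of the translates of φ
(`Equivariant.isCompl_span_ker`). Both are stable under translation, so an indecomposable W equals
the span, which is Σ[u,v]. Conversely, if Σ[u,v] ≅ Y ⊕ Z, the scalar 1 = φ(w) is the sum of a part
through Y and a part through Z. One part is nonzero, so I[u,v] is a summand of Y, say. The
independence of its translates gives Y the whole dimension of Σ[u,v], and Z = 0.

Suppose there is no finite interval summand. If an interval could start at an edge e (a map to the
right that is not surjective, or a map to the left that is not injective), it could never be
stopped, so it would split off from W cut at any later vertex (`exists_window`). The same holds at
all translates of e, and D + 1 such starts give D + 1 independent vectors in a space of dimension D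
= dim W_e, a contradiction (`Equivariant.isTightAt_of_no_interval`). So no interval starts anywhere.
Dimensions then weakly decrease to the right, are constant by periodicity, and all maps are
bijective. Such a W is the constant representation on its global sections, and indecomposability
makes that space one-dimensional. -/

theorem position_inj {x y : Fin n × ℤ} (h : position x = position y) : x = y := by
  obtain ⟨⟨i, hi⟩, c⟩ := x
  obtain ⟨⟨j, hj⟩, d⟩ := y
  simp only [position] at h
  have hc : c = d := by
    rcases lt_trichotomy c d with hcd | hcd | hcd
    · have : (c + 1) * (n : ℤ) ≤ d * n := mul_le_mul_of_nonneg_right (by omega) (by omega)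
      rw [add_mul] at this
      omega
    · exact hcd
    · have : (d + 1) * (n : ℤ) ≤ c * n := mul_le_mul_of_nonneg_right (by omega) (by omega)
      rw [add_mul] at this
      omega
  subst hc
  have : i = j := by omega
  subst this
  rfl

theorem exists_position_eq (hn : 1 < n) (q : ℤ) : ∃ x : Fin n × ℤ, position x = q := by
  have hn' : (0 : ℤ) < n := by omega
  have h0 := Int.emod_nonneg q hn'.ne'
  have h1 := Int.emod_lt_of_pos q hn'
  refine ⟨(⟨(q % n).toNat, by omega⟩, q / n), ?_⟩
  simp only [position]
  rw [Int.toNat_of_nonneg h0, mul_comm]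
  exact Int.emod_add_mul_ediv q n

theorem position_translate (x : Fin n × ℤ) (c : ℤ) :
    position (x.1, x.2 + c) = position x + c * n := by
  simp only [position]; ring

theorem position_eq_of_fst_eq {x y : Fin n × ℤ} (h : x.1 = y.1) :
    position y = position x + (y.2 - x.2) * n := by
  simp only [position, h]; ring

/-- For n = 1 the edge would be a loop, and comparing its source with its index would not reveal its
direction. -/
theorem cyclicPred_ne (hn : 1 < n) (j : Fin n) : cyclicPred j ≠ j := by
  intro h
  have := congrArg Fin.val h
  unfold cyclicPred at this
  split_ifs at this with h0
  · simp at this; omega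
  · simp at this; omega

/-- Vertices and edges are pairs of the same type, so `e` also denotes the right end of the edge
`e`, whose left end is at `position e - 1`. The condition `Q.src e.1 ≠ e.1` says that the edge
points to the right. -/
theorem tgt_of_right {e : Fin n × ℤ} (h : Q.src e.1 ≠ e.1) : unwoundTgt Q e = e := by
  have ht : Q.tgt e.1 = e.1 := by
    rcases Q.joins e.1 with h' | h'
    · exact h'.2
    · exact absurd h'.1 h
  simp [unwoundTgt, h, ht]

theorem position_src_of_right {e : Fin n × ℤ} (h : Q.src e.1 ≠ e.1) :
    position (unwoundSrc Q e) = position e - 1 := by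
  have ht : Q.src e.1 = cyclicPred e.1 := by
    rcases Q.joins e.1 with h' | h'
    · exact h'.1
    · exact absurd h'.1 h
  have := e.1.isLt
  simp only [unwoundSrc, h, if_false]
  split_ifs with h0
  · simp only [position, ht, cyclicPred, h0, if_true]
    push_cast [show 1 ≤ n by omega]
    ring
  · simp only [position, ht, cyclicPred, h0, if_false]
    push_cast [show 1 ≤ e.1.val by omega]
    ring

theorem src_of_left {e : Fin n × ℤ} (h : Q.src e.1 = e.1) : unwoundSrc Q e = e := by
  simp [unwoundSrc, h]

theorem position_tgt_of_left (hn : 1 < n) {e : Fin n × ℤ} (h : Q.src e.1 = e.1) :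
    position (unwoundTgt Q e) = position e - 1 := by
  have ht : Q.tgt e.1 = cyclicPred e.1 := by
    rcases Q.joins e.1 with h' | h'
    · exact absurd (h'.1.symm.trans h) (cyclicPred_ne hn _)
    · exact h'.2
  have := e.1.isLt
  simp only [unwoundTgt, h, if_true]
  split_ifs with h0
  · simp only [position, ht, cyclicPred, h0, if_true]
    push_cast [show 1 ≤ n by omega]
    ring
  · simp only [position, ht, cyclicPred, h0, if_false]
    push_cast [show 1 ≤ e.1.val by omega]
    ring

theorem src_translate (e : Fin n × ℤ) (c : ℤ) :
    unwoundSrc Q (e.1, e.2 + c) = ((unwoundSrc Q e).1, (unwoundSrc Q e).2 + c) := by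
  simp only [unwoundSrc]
  split_ifs <;> (simp; try ring)

theorem tgt_translate (e : Fin n × ℤ) (c : ℤ) :
    unwoundTgt Q (e.1, e.2 + c) = ((unwoundTgt Q e).1, (unwoundTgt Q e).2 + c) := by
  simp only [unwoundTgt]
  split_ifs <;> (simp; try ring)

theorem src_fst_congr {e e' : Fin n × ℤ} (h : e.1 = e'.1) :
    (unwoundSrc Q e).1 = (unwoundSrc Q e').1 := by
  have := src_translate (Q := Q) e (e'.2 - e.2)
  rw [show (e.1, e.2 + (e'.2 - e.2)) = e' by ext1 <;> simp [h]] at this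
  rw [this]

theorem tgt_fst_congr {e e' : Fin n × ℤ} (h : e.1 = e'.1) :
    (unwoundTgt Q e).1 = (unwoundTgt Q e').1 := by
  have := tgt_translate (Q := Q) e (e'.2 - e.2)
  rw [show (e.1, e.2 + (e'.2 - e.2)) = e' by ext1 <;> simp [h]] at this
  rw [this]

/-- Induction to the right along the line, one edge at a time. -/
theorem right_induction (hn : 1 < n) {P : Fin n × ℤ → Prop} {p : Fin n × ℤ} (h0 : P p)
    (hR : ∀ e, Q.src e.1 ≠ e.1 → position p ≤ position (unwoundSrc Q e) →
      P (unwoundSrc Q e) → P (unwoundTgt Q e))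
    (hL : ∀ e, Q.src e.1 = e.1 → position p ≤ position (unwoundTgt Q e) →
      P (unwoundTgt Q e) → P (unwoundSrc Q e)) :
    ∀ x, position p ≤ position x → P x := by
  have key : ∀ m, position p ≤ m → ∀ x : Fin n × ℤ, position x = m → P x := by
    intro m hm
    induction m, hm using Int.leInduction with
    | base => intro x hx; rwa [position_inj hx]
    | succ m hm ih =>
      intro x hx
      by_cases h : Q.src x.1 = x.1
      · have h1 := position_tgt_of_left hn h
        rw [← src_of_left h]
        exact hL x h (by omega) (ih _ (by omega))
      · have h1 := position_src_of_right h
        rw [← tgt_of_right h]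
        exact hR x h (by omega) (ih _ (by omega))
  exact fun x hx => key _ hx x rfl

/-- Induction in both directions along the line. -/
theorem line_induction (hn : 1 < n) {P : Fin n × ℤ → Prop} {p : Fin n × ℤ} (h0 : P p)
    (h : ∀ e, P (unwoundSrc Q e) ↔ P (unwoundTgt Q e)) (x : Fin n × ℤ) : P x := by
  rcases le_total (position p) (position x) with hx | hx
  · exact right_induction hn h0 (fun e _ _ => (h e).1) (fun e _ _ => (h e).2) x hx
  -- Going left is going right for the negated property: if `P x` failed, the failure would
  -- propagate from `x` to `p`.
  · by_contra hP
    exact right_induction (P := fun y => ¬ P y) hn hP (fun e _ _ => mt (h e).2)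
      (fun e _ _ => mt (h e).1) p hx h0

end Line

/-! ### Sections and cosections over intervals -/

section Sections

variable {K : Type u} [Field K] {n : ℕ} {Q : CyclicQuiver n}

/-- The linear map along an edge. -/
def edgeMap (W : Rep K (unwinding Q)) (e : Fin n × ℤ) :
    W.obj (unwoundSrc Q e) →ₗ[K] W.obj (unwoundTgt Q e) :=
  (W.map e).hom

/-- A morphism to `W` from the interval representation of `S`, within the part `B` of the line. -/
structure IsSection (W : Rep K (unwinding Q)) (B S : Set ℤ) (w : ∀ x, W.obj x) : Prop where
  eq_zero : ∀ x, position x ∉ S → w x = 0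
  map_eq : ∀ e, position (unwoundSrc Q e) ∈ B → position (unwoundTgt Q e) ∈ B →
    position (unwoundSrc Q e) ∈ S → edgeMap W e (w (unwoundSrc Q e)) = w (unwoundTgt Q e)

/-- A morphism from `W` to the interval representation of `S`, within the part `B` of the line. -/
structure IsCosection (W : Rep K (unwinding Q)) (B S : Set ℤ)
    (φ : ∀ x, W.obj x →ₗ[K] K) : Prop where
  eq_zero : ∀ x, position x ∉ S → φ x = 0
  map_eq : ∀ e, position (unwoundSrc Q e) ∈ B → position (unwoundTgt Q e) ∈ B →
    position (unwoundTgt Q e) ∈ S → ∀ a, φ (unwoundTgt Q e) (edgeMap W e a) =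
      φ (unwoundSrc Q e) a

variable {W : Rep K (unwinding Q)} {B S S' : Set ℤ} {w : ∀ x, W.obj x}
  {φ : ∀ x, W.obj x →ₗ[K] K}

theorem IsSection.pairing_eq (hw : IsSection W B S w) (hφ : IsCosection W B S' φ)
    (e : Fin n × ℤ) (hs : position (unwoundSrc Q e) ∈ B) (ht : position (unwoundTgt Q e) ∈ B)
    (hsS : position (unwoundSrc Q e) ∈ S) (htS : position (unwoundTgt Q e) ∈ S') :
    φ (unwoundTgt Q e) (w (unwoundTgt Q e)) = φ (unwoundSrc Q e) (w (unwoundSrc Q e)) := by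
  rw [← hw.map_eq e hs ht hsS, hφ.map_eq e hs ht htS]

/-- Section followed by cosection is a morphism between interval representations. Every edge between
`x` and `y` has both ends in both intervals, so the scalar does not change across it. -/
theorem IsSection.pairing_const (hn : 1 < n) {a b a' b' : ℤ} (hB : Set.Icc a b ⊆ B)
    (hw : IsSection W B (Set.Icc a b) w) (hφ : IsCosection W B (Set.Icc a' b') φ)
    {x y : Fin n × ℤ} (hxa : a ≤ position x) (hxa' : a' ≤ position x)
    (hxy : position x ≤ position y) (hyb : position y ≤ b) (hyb' : position y ≤ b') :
    φ y (w y) = φ x (w x) := by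
  refine right_induction (Q := Q) (p := x)
    (P := fun z => position z ≤ position y → φ z (w z) = φ x (w x)) hn (fun _ => rfl)
    ?_ ?_ y hxy le_rfl
  · intro e he h1 ih h2
    have h3 := position_src_of_right he
    rw [tgt_of_right he] at h2
    have h4 : position (unwoundTgt Q e) = position e := by rw [tgt_of_right he]
    rw [hw.pairing_eq hφ e (hB ⟨by omega, by omega⟩) (hB ⟨by omega, by omega⟩)
      ⟨by omega, by omega⟩ ⟨by omega, by omega⟩]
    exact ih (by omega)
  · intro e he h1 ih h2
    have h3 := position_tgt_of_left hn he
    have h4 : position (unwoundSrc Q e) = position e := by rw [src_of_left he]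
    rw [← hw.pairing_eq hφ e (hB ⟨by omega, by omega⟩) (hB ⟨by omega, by omega⟩)
      ⟨by omega, by omega⟩ ⟨by omega, by omega⟩]
    exact ih (by omega)

/-- The pairing vanishes if the cosection starts further to the right, at an edge pointing to the
right. -/
theorem IsSection.pairing_eq_zero_of_right (hn : 1 < n) {a b b' : ℤ} {e : Fin n × ℤ}
    (he : Q.src e.1 ≠ e.1) (hB : Set.Icc a b ⊆ B)
    (hw : IsSection W B (Set.Icc a b) w) (hφ : IsCosection W B (Set.Icc (position e) b') φ)
    (hae : a < position e) {y : Fin n × ℤ} (hy : position e ≤ position y)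
    (hyb : position y ≤ b) (hyb' : position y ≤ b') : φ y (w y) = 0 := by
  rw [hw.pairing_const hn hB hφ (x := e) hae.le le_rfl hy hyb hyb']
  have h3 := position_src_of_right he
  have h4 : position (unwoundTgt Q e) = position e := by rw [tgt_of_right he]
  have := hw.pairing_eq hφ e (hB ⟨by omega, by omega⟩) (hB ⟨by omega, by omega⟩)
    ⟨by omega, by omega⟩ ⟨by omega, by omega⟩
  -- The source of `e` is still in the interval of the section but just outside that of the
  -- cosection, where the form is zero.
  rw [hφ.eq_zero (unwoundSrc Q e) (fun h => by have := h.1; omega), tgt_of_right he] at this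
  exact this

/-- The pairing vanishes if the section starts further to the right, at an edge pointing to the
left. -/
theorem IsSection.pairing_eq_zero_of_left (hn : 1 < n) {b a' b' : ℤ} {e : Fin n × ℤ}
    (he : Q.src e.1 = e.1) (hB : Set.Icc (position e) b ⊆ B) (hB' : Set.Icc a' b' ⊆ B)
    (hw : IsSection W B (Set.Icc (position e) b) w) (hφ : IsCosection W B (Set.Icc a' b') φ)
    (hae : a' < position e) {y : Fin n × ℤ} (hy : position e ≤ position y)
    (hyb : position y ≤ b) (hyb' : position y ≤ b') : φ y (w y) = 0 := by
  rw [hw.pairing_const hn hB hφ (x := e) le_rfl hae.le hy hyb hyb']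
  have h3 := position_tgt_of_left hn he
  have h4 : position (unwoundSrc Q e) = position e := by rw [src_of_left he]
  have := hw.pairing_eq hφ e (hB ⟨by omega, by omega⟩) (hB' ⟨by omega, by omega⟩)
    ⟨by omega, by omega⟩ ⟨by omega, by omega⟩
  -- Here the target of `e` is in the interval of the cosection but just outside that of the
  -- section, where the vector is zero.
  rw [hw.eq_zero (unwoundTgt Q e) (fun h => by have := h.1; omega), src_of_left he,
    map_zero] at this
  exact this.symm

/-- Vectors with a unitriangular matrix of values of linear forms: a linear combination killed by
the forms is trivial. -/
theorem eq_zero_of_triangular {M ι : Type*} [AddCommGroup M] [Module K M] [LinearOrder ι]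
    (v : ι → M) (f : ι → M →ₗ[K] K) (h1 : ∀ i, f i (v i) = 1)
    (h0 : ∀ i j, i < j → f j (v i) = 0) (s : Finset ι) (g : ι → K)
    (hg : ∀ j ∈ s, f j (∑ i ∈ s, g i • v i) = 0) : ∀ i ∈ s, g i = 0 := by
  classical
  by_contra! hne
  obtain ⟨i, his, hi⟩ := hne
  have hT : (s.filter fun i => g i ≠ 0).Nonempty := ⟨i, by simp [his, hi]⟩
  obtain ⟨m, hm, hmax⟩ := (s.filter fun i => g i ≠ 0).exists_max_image id hT
  rw [Finset.mem_filter] at hm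
  refine hm.2 ?_
  have := hg m hm.1
  rw [map_sum, Finset.sum_eq_single m] at this
  · simpa [h1] using this
  · intro j hj hjm
    by_cases hgj : g j = 0
    · simp [hgj]
    · have : j ≤ m := hmax j (Finset.mem_filter.2 ⟨hj, hgj⟩)
      simp [h0 j m (lt_of_le_of_ne this hjm)]
  · exact fun h => absurd hm.1 h

/-- Sections over intervals with left ends in one residue class modulo `n`, which are dual to
cosections over the same intervals: a linear combination killed by the cosections is trivial. -/
theorem eq_zero_of_sections (hn : 1 < n) (e : Fin n × ℤ) (b : ℤ → ℤ) {ws : ℤ → ∀ x, W.obj x}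
    {φs : ℤ → ∀ x, W.obj x →ₗ[K] K} (I : Finset ℤ)
    (hB : ∀ c ∈ I, Set.Icc (position e + c * n) (b c) ⊆ B)
    (hw : ∀ c ∈ I, IsSection W B (Set.Icc (position e + c * n) (b c)) (ws c))
    (hφ : ∀ c ∈ I, IsCosection W B (Set.Icc (position e + c * n) (b c)) (φs c))
    (x : Fin n × ℤ) (hx : ∀ c ∈ I, position x ∈ Set.Icc (position e + c * n) (b c))
    (h1 : ∀ c ∈ I, φs c x (ws c x) = 1) (g : ℤ → K)
    (hg : ∀ d ∈ I, φs d x (∑ c ∈ I, g c • ws c x) = 0) : ∀ c ∈ I, g c = 0 := by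
  have hlt : ∀ c d : ℤ, c < d → position e + c * n < position e + d * n := fun c d h => by
    have : c * (n : ℤ) < d * n := mul_lt_mul_of_pos_right h (by omega)
    omega
  have hsum : ∑ c ∈ I, g c • ws c x = ∑ c ∈ I.attach, g c • ws c x :=
    (Finset.sum_attach I fun c => g c • ws c x).symm
  -- The edges at all left ends are translates of `e` and share its direction. Pointing to the right
  -- makes the pairings triangular for the order of the left ends; pointing to the left, for the
  -- opposite order.
  by_cases he : Q.src e.1 = e.1
  · have := eq_zero_of_triangular (ι := (↥I)ᵒᵈ) (fun c => ws (OrderDual.ofDual c).1 x)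
      (fun c => φs (OrderDual.ofDual c).1 x) (fun c => h1 _ (OrderDual.ofDual c).2)
      (fun i j hij => by
        set c := OrderDual.ofDual i
        set d := OrderDual.ofDual j
        have hcd : d.1 < c.1 := hij
        have hp := position_translate e c
        have hwc := hw c c.2
        have hBc := hB c c.2
        rw [← hp] at hwc hBc
        refine hwc.pairing_eq_zero_of_left hn (e := (e.1, e.2 + c)) he hBc (hB d d.2) (hφ d d.2)
          ?_ ?_ (hx c c.2).2 (hx d d.2).2
        · rw [hp]; exact hlt _ _ hcd
        · rw [hp]; exact (hx c c.2).1)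
      (Finset.univ : Finset (↥I)) (fun c => g (OrderDual.ofDual c).1)
      (fun d _ => by
        have := hg (OrderDual.ofDual d).1 (OrderDual.ofDual d).2
        rw [hsum] at this
        exact this)
    exact fun c hc => this ⟨c, hc⟩ (Finset.mem_univ _)
  · have := eq_zero_of_triangular (ι := ↥I) (fun c => ws c x) (fun c => φs c x)
      (fun c => h1 _ c.2)
      (fun c d hcd => by
        have hp := position_translate e d
        have hφd := hφ d d.2
        rw [← hp] at hφd
        refine (hw c c.2).pairing_eq_zero_of_right hn (e := (e.1, e.2 + d)) he (hB c c.2) hφd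
          ?_ ?_ (hx c c.2).2 (hx d d.2).2
        · rw [hp]; exact hlt _ _ hcd
        · rw [hp]; exact (hx d d.2).1)
      (Finset.univ : Finset (↥I)) (fun c => g c)
      (fun d _ => by
        have := hg d d.2
        rw [hsum] at this
        exact this)
    exact fun c hc => this ⟨c, hc⟩ (Finset.mem_univ _)

/-- In the situation of `eq_zero_of_sections`, the sections are linearly independent. -/
theorem linearIndependent_sections (hn : 1 < n) (e : Fin n × ℤ) (b : ℤ → ℤ)
    {ws : ℤ → ∀ x, W.obj x} {φs : ℤ → ∀ x, W.obj x →ₗ[K] K} (I : Finset ℤ)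
    (hB : ∀ c ∈ I, Set.Icc (position e + c * n) (b c) ⊆ B)
    (hw : ∀ c ∈ I, IsSection W B (Set.Icc (position e + c * n) (b c)) (ws c))
    (hφ : ∀ c ∈ I, IsCosection W B (Set.Icc (position e + c * n) (b c)) (φs c))
    (x : Fin n × ℤ) (hx : ∀ c ∈ I, position x ∈ Set.Icc (position e + c * n) (b c))
    (h1 : ∀ c ∈ I, φs c x (ws c x) = 1) :
    LinearIndependent K fun c : I => ws c x := by
  rw [Fintype.linearIndependent_iff]
  intro g hg i
  have := eq_zero_of_sections hn e b I hB hw hφ x hx h1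
    (fun c => if h : c ∈ I then g ⟨c, h⟩ else 0) (fun d _ => by
      rw [← Finset.sum_attach I, Finset.sum_congr rfl
        (g := fun c : I => g c • ws c x) (fun c _ => by simp)]
      rw [Finset.univ_eq_attach] at hg
      rw [hg, map_zero]) i i.2
  simpa using this

end Sections

/-! ### Linear relations along the line and the intervals they split off -/

section Transfer

/-- A linear form that vanishes on the kernel of a linear map factors through it. -/
theorem exists_comp_eq_of_ker_le {K A B C : Type*} [Field K] [AddCommGroup A] [Module K A]
    [AddCommGroup B] [Module K B] [AddCommGroup C] [Module K C] (g : A →ₗ[K] B) (f : A →ₗ[K] C)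
    (h : LinearMap.ker g ≤ LinearMap.ker f) : ∃ k : B →ₗ[K] C, ∀ a, k (g a) = f a := by
  obtain ⟨l, hl⟩ := LinearMap.exists_leftInverse_of_injective
    ((LinearMap.ker g).liftQ g le_rfl) (LinearMap.ker_eq_bot.2
      (LinearMap.ker_eq_bot.1 ((LinearMap.ker g).ker_liftQ_eq_bot _ _ le_rfl)))
  refine ⟨(LinearMap.ker g).liftQ f h ∘ₗ l, fun a => ?_⟩
  have : l (g a) = (LinearMap.ker g).mkQ a := LinearMap.congr_fun hl ((LinearMap.ker g).mkQ a)
  rw [LinearMap.comp_apply, this]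
  simp

variable {K : Type u} [Field K] {n : ℕ} {Q : CyclicQuiver n}

/-- A compatible family of vectors on the segment `[l, r]`. -/
def IsPath (W : Rep K (unwinding Q)) (l r : ℤ) (w : ∀ x, W.obj x) : Prop :=
  ∀ e, l ≤ position (unwoundSrc Q e) → l ≤ position (unwoundTgt Q e) →
    position (unwoundSrc Q e) ≤ r → position (unwoundTgt Q e) ≤ r →
    edgeMap W e (w (unwoundSrc Q e)) = w (unwoundTgt Q e)

/-- A compatible family of linear forms on the segment `[l, r]`. -/
def IsCopath (W : Rep K (unwinding Q)) (l r : ℤ) (φ : ∀ x, W.obj x →ₗ[K] K) : Prop :=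
  ∀ e, l ≤ position (unwoundSrc Q e) → l ≤ position (unwoundTgt Q e) →
    position (unwoundSrc Q e) ≤ r → position (unwoundTgt Q e) ≤ r →
    ∀ a, φ (unwoundTgt Q e) (edgeMap W e a) = φ (unwoundSrc Q e) a

variable {W : Rep K (unwinding Q)}

theorem src_tgt_cases (hn : 1 < n) (e : Fin n × ℤ) :
    (Q.src e.1 ≠ e.1 ∧ position (unwoundSrc Q e) = position e - 1 ∧
      position (unwoundTgt Q e) = position e) ∨
    (Q.src e.1 = e.1 ∧ position (unwoundSrc Q e) = position e ∧
      position (unwoundTgt Q e) = position e - 1) := by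
  by_cases h : Q.src e.1 = e.1
  · exact Or.inr ⟨h, by rw [src_of_left h], position_tgt_of_left hn h⟩
  · exact Or.inl ⟨h, position_src_of_right h, by rw [tgt_of_right h]⟩

/-- The vectors at `p` which are the beginning of a path from `p` to `x` ending in `S`. -/
def transfer (W : Rep K (unwinding Q)) (p x : Fin n × ℤ) (S : Submodule K (W.obj x)) :
    Submodule K (W.obj p) where
  carrier := {a | ∃ w, IsPath W (position p) (position x) w ∧ w p = a ∧ w x ∈ S}
  add_mem' := by
    rintro _ _ ⟨w, hw, rfl, hwS⟩ ⟨w', hw', rfl, hwS'⟩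
    exact ⟨fun y => w y + w' y, fun e h1 h2 h3 h4 => by
      rw [map_add, hw e h1 h2 h3 h4, hw' e h1 h2 h3 h4], rfl, add_mem hwS hwS'⟩
  zero_mem' := ⟨fun _ => 0, fun e _ _ _ _ => map_zero _, rfl, zero_mem S⟩
  smul_mem' := by
    rintro c _ ⟨w, hw, rfl, hwS⟩
    exact ⟨fun y => c • w y, fun e h1 h2 h3 h4 => by
      rw [map_smul, hw e h1 h2 h3 h4], rfl, S.smul_mem c hwS⟩

theorem transfer_self (hn : 1 < n) (p : Fin n × ℤ) (S : Submodule K (W.obj p)) :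
    transfer W p p S = S := by
  ext a
  constructor
  · rintro ⟨w, -, rfl, h⟩
    exact h
  · intro ha
    refine ⟨Function.update (fun _ => 0) p a, fun e h1 h2 h3 h4 => ?_, by simp, by simpa using ha⟩
    rcases src_tgt_cases (Q := Q) hn e with h | h <;> omega

/-- A path continues across an edge to the right in exactly one way, so the end condition is pulled
back. -/
theorem transfer_tgt (hn : 1 < n) {p e : Fin n × ℤ} (he : Q.src e.1 ≠ e.1)
    (hp : position p ≤ position (unwoundSrc Q e)) (S : Submodule K (W.obj (unwoundTgt Q e))) :
    transfer W p (unwoundTgt Q e) S = transfer W p (unwoundSrc Q e) (S.comap (edgeMap W e)) := by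
  have hs := position_src_of_right he
  have ht : position (unwoundTgt Q e) = position e := by rw [tgt_of_right he]
  ext a
  constructor
  · rintro ⟨w, hw, rfl, hS⟩
    refine ⟨w, fun e' h1 h2 h3 h4 => hw e' h1 h2 (by omega) (by omega), rfl, ?_⟩
    rw [Submodule.mem_comap, hw e (by omega) (by omega) (by omega) (by omega)]
    exact hS
  · rintro ⟨w, hw, rfl, hS⟩
    have hne : ∀ y, position y ≤ position (unwoundSrc Q e) → y ≠ unwoundTgt Q e := by
      rintro y hy rfl
      omega
    refine ⟨Function.update w (unwoundTgt Q e) (edgeMap W e (w (unwoundSrc Q e))),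
      fun e' h1 h2 h3 h4 => ?_, Function.update_of_ne (hne _ hp) _ _, by simpa using hS⟩
    by_cases hee : e' = e
    · subst hee
      rw [Function.update_self, Function.update_of_ne (hne _ le_rfl)]
    · have : position e' ≠ position e := fun h => hee (position_inj h)
      have hc := src_tgt_cases (Q := Q) hn e'
      rw [Function.update_of_ne (hne _ (by omega)), Function.update_of_ne (hne _ (by omega))]
      exact hw e' h1 h2 (by omega) (by omega)

/-- A path continues across an edge to the left by the choice of a preimage, so the end condition is
pushed forward. -/
theorem transfer_src (hn : 1 < n) {p e : Fin n × ℤ} (he : Q.src e.1 = e.1)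
    (hp : position p ≤ position (unwoundTgt Q e)) (S : Submodule K (W.obj (unwoundSrc Q e))) :
    transfer W p (unwoundSrc Q e) S = transfer W p (unwoundTgt Q e) (S.map (edgeMap W e)) := by
  have hs := position_tgt_of_left hn he
  have ht : position (unwoundSrc Q e) = position e := by rw [src_of_left he]
  ext a
  constructor
  · rintro ⟨w, hw, rfl, hS⟩
    refine ⟨w, fun e' h1 h2 h3 h4 => hw e' h1 h2 (by omega) (by omega), rfl, ?_⟩
    rw [← hw e (by omega) (by omega) (by omega) (by omega)]
    exact Submodule.mem_map_of_mem hS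
  · rintro ⟨w, hw, rfl, b, hb, hbw⟩
    have hne : ∀ y, position y ≤ position (unwoundTgt Q e) → y ≠ unwoundSrc Q e := by
      rintro y hy rfl
      omega
    refine ⟨Function.update w (unwoundSrc Q e) b,
      fun e' h1 h2 h3 h4 => ?_, Function.update_of_ne (hne _ hp) _ _, by simpa using hb⟩
    by_cases hee : e' = e
    · subst hee
      rw [Function.update_self, Function.update_of_ne (hne _ le_rfl), hbw]
    · have : position e' ≠ position e := fun h => hee (position_inj h)
      have hc := src_tgt_cases (Q := Q) hn e'
      rw [Function.update_of_ne (hne _ (by omega)), Function.update_of_ne (hne _ (by omega))]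
      exact hw e' h1 h2 (by omega) (by omega)

/-- A linear form at `p` extends to a compatible family on `[p, x]` with last member killing `S` as
soon as it kills the beginnings of the paths ending in `S`. -/
theorem exists_copath (hn : 1 < n) {p : Fin n × ℤ} (f : W.obj p →ₗ[K] K) :
    ∀ x, position p ≤ position x → ∀ S : Submodule K (W.obj x),
      transfer W p x S ≤ LinearMap.ker f → ∃ φ : ∀ x, W.obj x →ₗ[K] K,
        IsCopath W (position p) (position x) φ ∧ φ p = f ∧ S ≤ LinearMap.ker (φ x) := by
  refine right_induction (Q := Q) hn ?_ ?_ ?_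
  · intro S hS
    rw [transfer_self hn] at hS
    refine ⟨Function.update (fun _ => 0) p f, fun e h1 h2 h3 h4 => ?_, by simp, by simpa using hS⟩
    rcases src_tgt_cases (Q := Q) hn e with h | h <;> omega
  · intro e he hp ih S hS
    have hs := position_src_of_right he
    have ht : position (unwoundTgt Q e) = position e := by rw [tgt_of_right he]
    rw [transfer_tgt hn he hp] at hS
    obtain ⟨φ, hφ, rfl, hφS⟩ := ih _ hS
    have hne : ∀ y, position y ≤ position (unwoundSrc Q e) → y ≠ unwoundTgt Q e := by
      rintro y hy rfl
      omega
    -- The form at the source kills the preimage of `S`, which is the kernel of the map to the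
    -- quotient by `S`; hence it factors through that quotient.
    obtain ⟨k, hk⟩ := exists_comp_eq_of_ker_le (S.mkQ ∘ₗ edgeMap W e) (φ (unwoundSrc Q e))
      (by rwa [LinearMap.ker_comp, Submodule.ker_mkQ])
    refine ⟨Function.update φ (unwoundTgt Q e) (k ∘ₗ S.mkQ), fun e' h1 h2 h3 h4 => ?_,
      Function.update_of_ne (hne _ hp) _ _, ?_⟩
    · by_cases hee : e' = e
      · subst hee
        rw [Function.update_self, Function.update_of_ne (hne _ le_rfl)]
        exact hk
      · have : position e' ≠ position e := fun h => hee (position_inj h)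
        have hc := src_tgt_cases (Q := Q) hn e'
        rw [Function.update_of_ne (hne _ (by omega)), Function.update_of_ne (hne _ (by omega))]
        exact hφ e' h1 h2 (by omega) (by omega)
    · rw [Function.update_self]
      intro b hb
      simp [(Submodule.Quotient.mk_eq_zero S).2 hb]
  · intro e he hp ih S hS
    have hs := position_tgt_of_left hn he
    have ht : position (unwoundSrc Q e) = position e := by rw [src_of_left he]
    rw [transfer_src hn he hp] at hS
    obtain ⟨φ, hφ, rfl, hφS⟩ := ih _ hS
    have hne : ∀ y, position y ≤ position (unwoundTgt Q e) → y ≠ unwoundSrc Q e := by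
      rintro y hy rfl
      omega
    -- Across an edge to the left the new form is forced: it is the old one composed with the edge
    -- map.
    refine ⟨Function.update φ (unwoundSrc Q e) (φ (unwoundTgt Q e) ∘ₗ edgeMap W e),
      fun e' h1 h2 h3 h4 => ?_, Function.update_of_ne (hne _ hp) _ _, ?_⟩
    · by_cases hee : e' = e
      · subst hee
        rw [Function.update_self, Function.update_of_ne (hne _ le_rfl)]
        exact fun _ => rfl
      · have : position e' ≠ position e := fun h => hee (position_inj h)
        have hc := src_tgt_cases (Q := Q) hn e'
        rw [Function.update_of_ne (hne _ (by omega)), Function.update_of_ne (hne _ (by omega))]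
        exact hφ e' h1 h2 (by omega) (by omega)
    · rw [Function.update_self]
      exact fun b hb => hφS (Submodule.mem_map_of_mem hb)

/-- Dual families of vectors and linear forms on `[p, x]` with prescribed ends. -/
theorem exists_path_copath (hn : 1 < n) {p x : Fin n × ℤ} (hx : position p ≤ position x)
    (A Z : Submodule K (W.obj p)) (S T : Submodule K (W.obj x))
    (h : ¬ transfer W p x S ⊓ A ≤ transfer W p x T ⊔ Z) :
    ∃ (w : ∀ y, W.obj y) (φ : ∀ y, W.obj y →ₗ[K] K),
      IsPath W (position p) (position x) w ∧ IsCopath W (position p) (position x) φ ∧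
      w p ∈ A ∧ Z ≤ LinearMap.ker (φ p) ∧ w x ∈ S ∧ T ≤ LinearMap.ker (φ x) ∧
      φ p (w p) = 1 := by
  obtain ⟨a, ⟨⟨w, hw, hwp, hwS⟩, haA⟩, ha⟩ := SetLike.not_le_iff_exists.1 h
  -- The path starts at a vector `a` witnessing the failed inclusion, and the copath at a form that
  -- separates `a` from the right-hand side, rescaled to be 1 on `a`.
  obtain ⟨f, hfa, hf⟩ := Submodule.exists_le_ker_of_notMem ha
  have hf' : transfer W p x T ⊔ Z ≤ LinearMap.ker ((f a)⁻¹ • f) := fun b hb => by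
    have : f b = 0 := hf hb
    simp [this]
  obtain ⟨φ, hφ, hφp, hφT⟩ := exists_copath hn ((f a)⁻¹ • f) x hx T (le_sup_left.trans hf')
  refine ⟨w, φ, hw, hφ, hwp ▸ haA, hφp ▸ le_sup_right.trans hf', hwS, hφT, ?_⟩
  rw [hφp, hwp]
  simp [hfa]

/-- If no finite interval starting at `p` splits off, then intervals reaching arbitrarily far to
the right do. -/
theorem transfer_bounds (hn : 1 < n) {p : Fin n × ℤ} (A Z : Submodule K (W.obj p)) (hZA : Z ≤ A)
    (hR : ∀ e, Q.src e.1 ≠ e.1 → position p ≤ position (unwoundSrc Q e) →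
      transfer W p (unwoundSrc Q e) (LinearMap.ker (edgeMap W e)) ⊓ A ≤
        transfer W p (unwoundSrc Q e) ⊥ ⊔ Z)
    (hL : ∀ e, Q.src e.1 = e.1 → position p ≤ position (unwoundTgt Q e) →
      transfer W p (unwoundTgt Q e) ⊤ ⊓ A ≤
        transfer W p (unwoundTgt Q e) (LinearMap.range (edgeMap W e)) ⊔ Z) :
    ∀ x, position p ≤ position x →
      transfer W p x ⊥ ⊓ A ≤ Z ∧ A ≤ transfer W p x ⊤ ⊔ Z := by
  refine right_induction (Q := Q) hn ?_ ?_ ?_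
  · rw [transfer_self hn, transfer_self hn]
    exact ⟨by simp, by simp⟩
  -- An edge to the right leaves the condition `⊤` alone and turns `⊥` into the kernel of its map,
  -- which `hR` reduces to `⊥`.
  · intro e he hp ⟨ih1, ih2⟩
    rw [transfer_tgt hn he hp, transfer_tgt hn he hp, Submodule.comap_top]
    refine ⟨fun a ha => ?_, ih2⟩
    obtain ⟨k, hk, z, hz, rfl⟩ := Submodule.mem_sup.1 (hR e he hp ha)
    refine add_mem (ih1 ⟨hk, ?_⟩) hz
    simpa using sub_mem ha.2 (hZA hz)
  -- An edge to the left leaves `⊥` alone and turns `⊤` into the range of its map, to which `hL`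
  -- reduces `⊤`.
  · intro e he hp ⟨ih1, ih2⟩
    rw [transfer_src hn he hp, transfer_src hn he hp, Submodule.map_bot, Submodule.map_top]
    refine ⟨ih1, fun a ha => ?_⟩
    obtain ⟨k, hk, z, hz, rfl⟩ := Submodule.mem_sup.1 (ih2 ha)
    refine add_mem (hL e he hp ⟨hk, ?_⟩) (Submodule.mem_sup_right hz)
    simpa using sub_mem ha (hZA hz)

/-! ### Interval summands, and intervals in a window -/

/-- The interval representation of `[u, v]` is a direct summand of `W`. -/
def HasIntervalSummand (W : Rep K (unwinding Q)) (u v : ℤ) : Prop :=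
  ∃ (w : ∀ x, W.obj x) (φ : ∀ x, W.obj x →ₗ[K] K), IsSection W Set.univ (Set.Icc u v) w ∧
    IsCosection W Set.univ (Set.Icc u v) φ ∧ ∀ x, position x ∈ Set.Icc u v → φ x (w x) = 1

/-- Extension by zero needs checking only at edges that leave the segment: one to the left at `l`,
or one to the right at `r + 1`. The latter is vacuous when `B` stops at `r`, which is what makes
windows easier than summands. -/
theorem IsPath.isSection (hn : 1 < n) {l r : ℤ} {w : ∀ x, W.obj x} (hw : IsPath W l r w)
    (B : Set ℤ)
    (hl : ∀ e, Q.src e.1 = e.1 → position e = l →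
      edgeMap W e (w (unwoundSrc Q e)) = 0)
    (hr : ∀ e, Q.src e.1 ≠ e.1 → position e = r + 1 → r + 1 ∈ B →
      edgeMap W e (w (unwoundSrc Q e)) = 0) :
    IsSection W B (Set.Icc l r) (fun x => if position x ∈ Set.Icc l r then w x else 0) where
  eq_zero x hx := if_neg hx
  map_eq e _ hB hs := by
    rw [if_pos hs]
    split_ifs with ht
    · exact hw e hs.1 ht.1 hs.2 ht.2
    · rw [Set.mem_Icc] at hs ht
      rcases src_tgt_cases (Q := Q) hn e with h | h
      · have : position e = r + 1 := by omega
        refine hr e h.1 this ?_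
        rwa [← this, ← h.2.2]
      · exact hl e h.1 (by omega)

/-- Dually, only edges that enter the segment from outside impose a condition. -/
theorem IsCopath.isCosection (hn : 1 < n) {l r : ℤ} {φ : ∀ x, W.obj x →ₗ[K] K}
    (hφ : IsCopath W l r φ) (B : Set ℤ)
    (hl : ∀ e, Q.src e.1 ≠ e.1 → position e = l → ∀ a, φ (unwoundTgt Q e) (edgeMap W e a) = 0)
    (hr : ∀ e, Q.src e.1 = e.1 → position e = r + 1 → r + 1 ∈ B →
      ∀ a, φ (unwoundTgt Q e) (edgeMap W e a) = 0) :
    IsCosection W B (Set.Icc l r) (fun x => if position x ∈ Set.Icc l r then φ x else 0) where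
  eq_zero x hx := if_neg hx
  map_eq e hB _ ht a := by
    rw [if_pos ht]
    split_ifs with hs
    · exact hφ e hs.1 ht.1 hs.2 ht.2 a
    · rw [Set.mem_Icc] at hs ht
      rcases src_tgt_cases (Q := Q) hn e with h | h
      · exact hl e h.1 (by omega) a
      · have : position e = r + 1 := by omega
        refine hr e h.1 this ?_ a
        rwa [← this, ← h.2.1]

theorem pairing_path_copath (hn : 1 < n) {l r : ℤ} {w : ∀ x, W.obj x}
    {φ : ∀ x, W.obj x →ₗ[K] K} (hw : IsPath W l r w) (hφ : IsCopath W l r φ) {p : Fin n × ℤ}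
    (hp : position p = l) : ∀ x, position p ≤ position x → position x ≤ r →
      φ x (w x) = φ p (w p) := by
  refine right_induction (Q := Q) hn (fun _ => rfl) ?_ ?_
  · intro e he h1 ih h2
    have hc := src_tgt_cases (Q := Q) hn e
    rw [← hw e (by omega) (by omega) (by omega) (by omega),
      hφ e (by omega) (by omega) (by omega) (by omega), ih (by omega)]
  · intro e he h1 ih h2
    have hc := src_tgt_cases (Q := Q) hn e
    rw [← hφ e (by omega) (by omega) (by omega) (by omega),
      hw e (by omega) (by omega) (by omega) (by omega), ih (by omega)]

/-- The edge `e` allows no interval to start at its right end: its map is surjective if it points to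
the right, and injective if it points to the left. -/
def IsTightAt (W : Rep K (unwinding Q)) (e : Fin n × ℤ) : Prop :=
  (Q.src e.1 ≠ e.1 → Function.Surjective (edgeMap W e)) ∧
    (Q.src e.1 = e.1 → Function.Injective (edgeMap W e))

/-- If intervals start at `e` but no finite interval is a direct summand, then intervals starting
at `e` split off from all bounded parts of the representation. -/
theorem exists_window_of_start (hn : 1 < n) {e p x : Fin n × ℤ} (hpe : position p = position e)
    (hx : position p ≤ position x) (hfin : ∀ u v, u ≤ v → ¬ HasIntervalSummand W u v)
    (A Z : Submodule K (W.obj p)) (hZA : Z < A)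
    (hleft : ∀ w : ∀ y, W.obj y, w p ∈ A → ∀ e', Q.src e'.1 = e'.1 → position e' = position e →
      edgeMap W e' (w (unwoundSrc Q e')) = 0)
    (hright : ∀ φ : ∀ y, W.obj y →ₗ[K] K, Z ≤ LinearMap.ker (φ p) → ∀ e', Q.src e'.1 ≠ e'.1 →
      position e' = position e → ∀ a, φ (unwoundTgt Q e') (edgeMap W e' a) = 0) :
    ∃ (w : ∀ y, W.obj y) (φ : ∀ y, W.obj y →ₗ[K] K),
      IsSection W (Set.Iic (position x)) (Set.Icc (position e) (position x)) w ∧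
      IsCosection W (Set.Iic (position x)) (Set.Icc (position e) (position x)) φ ∧
      φ x (w x) = 1 := by
  -- A failure of `hR` at `e'` gives a path that dies in the kernel of `e'`. A failure of `hL` gives
  -- a copath that kills the range of `e'`. Either one ends an interval just before `e'`, producing
  -- a forbidden finite summand.
  have key := transfer_bounds (W := W) hn A Z hZA.le (fun e' he' hp => by
      by_contra hcon
      obtain ⟨w, φ, hw, hφ, hwp, hφp, hwx, hφx, h1⟩ := exists_path_copath hn hp A Z _ _ hcon
      have hs := position_src_of_right he'
      refine hfin _ _ hp ⟨_, _, hw.isSection hn _ ?_ ?_, hφ.isCosection hn _ ?_ ?_, fun y hy => ?_⟩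
      · exact fun e'' h1 h2 => hleft w hwp e'' h1 (by omega)
      · intro e'' h1 h2 _
        obtain rfl : e'' = e' := position_inj (by omega)
        exact hwx
      · exact fun e'' h1 h2 => hright φ hφp e'' h1 (by omega)
      · intro e'' h1 h2 _
        obtain rfl : e'' = e' := position_inj (by omega)
        exact absurd h1 he'
      · rw [if_pos hy, if_pos hy, pairing_path_copath hn hw hφ rfl y hy.1 hy.2, h1])
    (fun e' he' hp => by
      by_contra hcon
      obtain ⟨w, φ, hw, hφ, hwp, hφp, hwx, hφx, h1⟩ := exists_path_copath hn hp A Z _ _ hcon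
      have hs := position_tgt_of_left hn he'
      refine hfin _ _ hp ⟨_, _, hw.isSection hn _ ?_ ?_, hφ.isCosection hn _ ?_ ?_, fun y hy => ?_⟩
      · exact fun e'' h1 h2 => hleft w hwp e'' h1 (by omega)
      · intro e'' h1 h2 _
        obtain rfl : e'' = e' := position_inj (by omega)
        exact absurd he' h1
      · exact fun e'' h1 h2 => hright φ hφp e'' h1 (by omega)
      · intro e'' h1 h2 _ a
        obtain rfl : e'' = e' := position_inj (by omega)
        exact hφx (LinearMap.mem_range_self _ a)
      · rw [if_pos hy, if_pos hy, pairing_path_copath hn hw hφ rfl y hy.1 hy.2, h1]) x hx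
  -- Otherwise the two bounds of `key` combine to give `A ≤ Z`.
  have hcon : ¬ transfer W p x ⊤ ⊓ A ≤ transfer W p x ⊥ ⊔ Z := by
    intro hcon
    refine hZA.not_ge fun a ha => ?_
    obtain ⟨i, hi, z, hz, rfl⟩ := Submodule.mem_sup.1 (key.2 ha)
    have hiA : i ∈ A := by simpa using sub_mem ha (hZA.le hz)
    obtain ⟨k, hk, z', hz', rfl⟩ := Submodule.mem_sup.1 (hcon ⟨hi, hiA⟩)
    refine add_mem (add_mem (key.1 ⟨hk, ?_⟩) hz') hz
    simpa using sub_mem hiA (hZA.le hz')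
  obtain ⟨w, φ, hw, hφ, hwp, hφp, -, -, h1⟩ := exists_path_copath hn hx A Z _ _ hcon
  rw [← hpe]
  refine ⟨_, _, hw.isSection hn _ ?_ ?_, hφ.isCosection hn _ ?_ ?_, ?_⟩
  · exact fun e'' h1 h2 => hleft w hwp e'' h1 (by omega)
  · intro e'' h1 h2 h3
    have : position x + 1 ≤ position x := h3
    omega
  · exact fun e'' h1 h2 => hright φ hφp e'' h1 (by omega)
  · intro e'' h1 h2 h3 a
    have : position x + 1 ≤ position x := h3
    omega
  · rw [if_pos ⟨hx, le_rfl⟩, if_pos ⟨hx, le_rfl⟩,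
      pairing_path_copath hn hw hφ rfl x hx le_rfl, h1]

/-- For an edge to the left, an interval must start in the kernel: `A` is the kernel and `Z` is
zero. For an edge to the right, it must be visible modulo the range: `A` is everything and `Z` is
the range. In both cases failure of tightness is exactly `Z < A`. -/
theorem exists_window (hn : 1 < n) {e x : Fin n × ℤ} (hx : position e ≤ position x)
    (hfin : ∀ u v, u ≤ v → ¬ HasIntervalSummand W u v) (he : ¬ IsTightAt W e) :
    ∃ (w : ∀ y, W.obj y) (φ : ∀ y, W.obj y →ₗ[K] K),
      IsSection W (Set.Iic (position x)) (Set.Icc (position e) (position x)) w ∧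
      IsCosection W (Set.Iic (position x)) (Set.Icc (position e) (position x)) φ ∧
      φ x (w x) = 1 := by
  by_cases h : Q.src e.1 = e.1
  · have hs : position (unwoundSrc Q e) = position e := by rw [src_of_left h]
    refine exists_window_of_start hn hs (hs ▸ hx) hfin (LinearMap.ker (edgeMap W e)) ⊥
      (bot_lt_iff_ne_bot.2 fun hbot => he ⟨fun h' => absurd h h',
        fun _ => LinearMap.ker_eq_bot.1 hbot⟩) ?_ ?_
    · intro w hw e' _ h2
      obtain rfl := position_inj h2
      exact hw
    · intro φ _ e' h1 h2
      obtain rfl := position_inj h2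
      exact absurd h h1
  · have hs : position (unwoundTgt Q e) = position e := by rw [tgt_of_right h]
    refine exists_window_of_start hn hs (hs ▸ hx) hfin ⊤ (LinearMap.range (edgeMap W e))
      (lt_top_iff_ne_top.2 fun htop => he ⟨fun _ => LinearMap.range_eq_top.1 htop,
        fun h' => absurd h' h⟩) ?_ ?_
    · intro w _ e' h1 h2
      obtain rfl := position_inj h2
      exact absurd h1 h
    · intro φ hφ e' _ h2 a
      obtain rfl := position_inj h2
      exact hφ (LinearMap.mem_range_self _ a)

end Transfer

/-! ### Translations, and the bijectivity of the maps when no finite interval splits off -/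

section Equivariant

variable {K : Type u} [Field K] {n : ℕ} {Q : CyclicQuiver n}

/-- A coherent action of the translations of the unwinding on a representation. -/
structure Equivariant (W : Rep K (unwinding Q)) where
  /-- the linear map between the spaces at two translates of a vertex -/
  tr : ∀ x y : Fin n × ℤ, x.1 = y.1 → (W.obj x →ₗ[K] W.obj y)
  refl : ∀ x a, tr x x rfl a = a
  trans : ∀ (x y z : Fin n × ℤ) (hxy : x.1 = y.1) (hyz : y.1 = z.1) (hxz : x.1 = z.1) (a),
    tr y z hyz (tr x y hxy a) = tr x z hxz a
  comm : ∀ (e e' : Fin n × ℤ) (_ : e.1 = e'.1)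
    (hs : (unwoundSrc Q e).1 = (unwoundSrc Q e').1) (ht : (unwoundTgt Q e).1 = (unwoundTgt Q e').1)
    (a), tr _ _ ht (edgeMap W e a) = edgeMap W e' (tr _ _ hs a)

namespace Equivariant

variable {W : Rep K (unwinding Q)}

theorem tr_tr_symm (E : Equivariant W) {x y : Fin n × ℤ} (h : x.1 = y.1) (h' : y.1 = x.1)
    (a : W.obj x) :
    E.tr y x h' (E.tr x y h a) = a := by
  rw [E.trans x y x h h' rfl, E.refl]

/-- The spaces at two translates of a vertex are isomorphic. -/
def equiv (E : Equivariant W) (x y : Fin n × ℤ) (h : x.1 = y.1) : W.obj x ≃ₗ[K] W.obj y :=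
  { E.tr x y h with
    invFun := E.tr y x h.symm
    left_inv := E.tr_tr_symm h h.symm
    right_inv := E.tr_tr_symm h.symm h }

theorem tr_bijective (E : Equivariant W) (x y : Fin n × ℤ) (h : x.1 = y.1) : Function.Bijective
    (E.tr x y h) :=
  (E.equiv x y h).bijective

theorem tr_section_congr (E : Equivariant W) (w : ∀ x, W.obj x) {x x' y : Fin n × ℤ}
    (hx : x = x') (h : x.1 = y.1)
    (h' : x'.1 = y.1) : E.tr x y h (w x) = E.tr x' y h' (w x') := by
  subst hx; rfl

theorem tr_cosection_congr (E : Equivariant W) (φ : ∀ x, W.obj x →ₗ[K] K) {x x' y : Fin n × ℤ}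
    (hx : x = x')
    (h : y.1 = x.1) (h' : y.1 = x'.1) (a : W.obj y) :
    φ x (E.tr y x h a) = φ x' (E.tr y x' h' a) := by
  subst hx; rfl

theorem isTightAt (E : Equivariant W) {e e' : Fin n × ℤ} (h : e.1 = e'.1)
    (ht : IsTightAt W e) : IsTightAt W e' := by
  have hs := src_fst_congr (Q := Q) h
  have ht' := tgt_fst_congr (Q := Q) h
  refine ⟨fun h1 b => ?_, fun h1 => ?_⟩
  · obtain ⟨a, ha⟩ := ht.1 (by rwa [h]) (E.tr _ _ ht'.symm b)
    refine ⟨E.tr _ _ hs a, ?_⟩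
    rw [← E.comm e e' h hs ht', ha, E.tr_tr_symm]
  · intro a b hab
    refine (E.tr_bijective _ _ hs.symm).1 (ht.2 (by rwa [h]) ?_)
    rw [← E.comm e' e h.symm hs.symm ht'.symm, hab, E.comm e' e h.symm hs.symm ht'.symm]

/-- The translate of a family of vectors by `c` periods. -/
def translate (E : Equivariant W) (w : ∀ x, W.obj x) (c : ℤ) : ∀ x, W.obj x :=
  fun x => E.tr (x.1, x.2 - c) x rfl (w (x.1, x.2 - c))

/-- The translate of a family of linear forms by `c` periods. -/
def cotranslate (E : Equivariant W) (φ : ∀ x, W.obj x →ₗ[K] K) (c : ℤ) : ∀ x, W.obj x →ₗ[K] K :=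
  fun x => φ (x.1, x.2 - c) ∘ₗ E.tr x (x.1, x.2 - c) rfl

theorem position_sub (x : Fin n × ℤ) (c : ℤ) :
    position (x.1, x.2 - c) = position x - c * n := by
  simp only [position]; ring

theorem position_sub_mem_iff (x : Fin n × ℤ) (c u v : ℤ) :
    position (x.1, x.2 - c) ∈ Set.Icc u v ↔
      position x ∈ Set.Icc (u + c * n) (v + c * n) := by
  rw [position_sub, Set.mem_Icc, Set.mem_Icc]
  constructor <;> rintro ⟨h1, h2⟩ <;> constructor <;> omega

theorem src_sub (e : Fin n × ℤ) (c : ℤ) :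
    ((unwoundSrc Q e).1, (unwoundSrc Q e).2 - c) = unwoundSrc Q (e.1, e.2 - c) := by
  simp only [sub_eq_add_neg, src_translate]

theorem tgt_sub (e : Fin n × ℤ) (c : ℤ) :
    ((unwoundTgt Q e).1, (unwoundTgt Q e).2 - c) = unwoundTgt Q (e.1, e.2 - c) := by
  simp only [sub_eq_add_neg, tgt_translate]

theorem isSection_translate (E : Equivariant W) {w : ∀ x, W.obj x} {u v : ℤ}
    (hw : IsSection W Set.univ (Set.Icc u v) w) (c : ℤ) :
    IsSection W Set.univ (Set.Icc (u + c * n) (v + c * n)) (E.translate w c) where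
  eq_zero x hx := by
    rw [← position_sub_mem_iff] at hx
    rw [translate, hw.eq_zero _ hx, map_zero]
  map_eq e _ _ hs := by
    rw [← position_sub_mem_iff, src_sub] at hs
    have hs' := src_fst_congr (Q := Q) (e := (e.1, e.2 - c)) (e' := e) rfl
    have ht' := tgt_fst_congr (Q := Q) (e := (e.1, e.2 - c)) (e' := e) rfl
    rw [translate, translate, E.tr_section_congr w (src_sub e c) _ hs',
      E.tr_section_congr w (tgt_sub e c) _ ht', ← E.comm (e.1, e.2 - c) e rfl hs' ht',
      hw.map_eq _ trivial trivial hs]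

theorem isCosection_cotranslate (E : Equivariant W) {φ : ∀ x, W.obj x →ₗ[K] K} {u v : ℤ}
    (hφ : IsCosection W Set.univ (Set.Icc u v) φ) (c : ℤ) :
    IsCosection W Set.univ (Set.Icc (u + c * n) (v + c * n)) (E.cotranslate φ c) where
  eq_zero x hx := by
    rw [← position_sub_mem_iff] at hx
    rw [cotranslate, hφ.eq_zero _ hx, LinearMap.zero_comp]
  map_eq e _ _ ht a := by
    rw [← position_sub_mem_iff, tgt_sub] at ht
    have hs' := src_fst_congr (Q := Q) (e := e) (e' := (e.1, e.2 - c)) rfl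
    have ht' := tgt_fst_congr (Q := Q) (e := e) (e' := (e.1, e.2 - c)) rfl
    rw [cotranslate, cotranslate, LinearMap.comp_apply, LinearMap.comp_apply,
      E.tr_cosection_congr φ (src_sub e c) _ hs', E.tr_cosection_congr φ (tgt_sub e c) _ ht',
      E.comm e (e.1, e.2 - c) rfl hs' ht', hφ.map_eq _ trivial trivial ht]

theorem cotranslate_translate (E : Equivariant W) (φ : ∀ x, W.obj x →ₗ[K] K) (w : ∀ x, W.obj x)
    (c : ℤ)
    (x : Fin n × ℤ) : E.cotranslate φ c x (E.translate w c x) =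
      φ (x.1, x.2 - c) (w (x.1, x.2 - c)) := by
  rw [cotranslate, translate, LinearMap.comp_apply, E.tr_tr_symm]

theorem tr_translate (E : Equivariant W) (w : ∀ x, W.obj x) (c : ℤ) {x y : Fin n × ℤ}
    (h : x.1 = y.1) :
    E.tr x y h (E.translate w c x) = E.translate w (c + (y.2 - x.2)) y := by
  rw [translate, translate, E.trans (x.1, x.2 - c) x y rfl h h]
  exact E.tr_section_congr w (by rw [h]; congr 1; ring) _ _

theorem cotranslate_tr (E : Equivariant W) (φ : ∀ x, W.obj x →ₗ[K] K) (c : ℤ) {x y : Fin n × ℤ}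
    (h : x.1 = y.1)
    (a : W.obj x) : E.cotranslate φ c y (E.tr x y h a) =
      E.cotranslate φ (c + (x.2 - y.2)) x a := by
  rw [cotranslate, cotranslate, LinearMap.comp_apply, LinearMap.comp_apply,
    E.trans x y (y.1, y.2 - c) h rfl h]
  exact E.tr_cosection_congr φ (by rw [h]; congr 1; ring) _ _ _

theorem finrank_eq (E : Equivariant W) {x y : Fin n × ℤ} (h : x.1 = y.1) :
    Module.finrank K (W.obj x) = Module.finrank K (W.obj y) :=
  (E.equiv x y h).finrank_eq

/-- Without finite interval summands no interval starts anywhere. -/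
theorem isTightAt_of_no_interval (E : Equivariant W) (hn : 1 < n) (hW : W.IsPointwiseFinite)
    (hfin : ∀ u v, u ≤ v → ¬ HasIntervalSummand W u v) (e : Fin n × ℤ) : IsTightAt W e := by
  by_contra he
  obtain ⟨D, hD⟩ : ∃ D : ℤ, D = (Module.finrank K (W.obj e) : ℕ) := ⟨_, rfl⟩
  -- Going `D` periods to the right leaves room for the `D + 1` starting points `e + cn`, `0 ≤ c ≤
  -- D`, while the space at `x` still has dimension `D`.
  set x : Fin n × ℤ := (e.1, e.2 + D) with hx
  have hpx : position x = position e + D * n := position_translate e D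
  have hle : ∀ c ∈ Finset.Icc 0 D, position e + c * n ≤ position x := fun c hc => by
    have : c * (n : ℤ) ≤ D * n :=
      mul_le_mul_of_nonneg_right (Finset.mem_Icc.1 hc).2 (by omega)
    omega
  have hex : ∀ c : ℤ, ∃ (w : ∀ y, W.obj y) (φ : ∀ y, W.obj y →ₗ[K] K), c ∈ Finset.Icc 0 D →
      IsSection W (Set.Iic (position x)) (Set.Icc (position e + c * n) (position x)) w ∧
      IsCosection W (Set.Iic (position x)) (Set.Icc (position e + c * n) (position x)) φ ∧
      φ x (w x) = 1 := by
    intro c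
    by_cases hc : c ∈ Finset.Icc 0 D
    · have hp := position_translate e c
      obtain ⟨w, φ, h⟩ := exists_window (W := W) hn (e := (e.1, e.2 + c)) (x := x)
        (by rw [hp]; exact hle c hc) hfin
        (fun h => he (E.isTightAt (e := (e.1, e.2 + c)) rfl h))
      rw [hp] at h
      exact ⟨w, φ, fun _ => h⟩
    · exact ⟨fun _ => 0, fun _ => 0, fun h => absurd h hc⟩
  choose ws φs h using hex
  have hli := linearIndependent_sections hn e (fun _ => position x) (Finset.Icc 0 D)
    (fun c _ => Set.Icc_subset_Iic_self) (fun c hc => (h c hc).1) (fun c hc => (h c hc).2.1) x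
    (fun c hc => ⟨hle c hc, le_rfl⟩) (fun c hc => (h c hc).2.2)
  have := hW x
  have hcard := hli.fintype_card_le_finrank
  rw [E.finrank_eq (x := x) (y := e) rfl, Fintype.card_coe, Int.card_Icc] at hcard
  omega

/-- Without finite interval summands all the linear maps are bijective. -/
theorem bijective_of_no_interval (E : Equivariant W) (hn : 1 < n) (hW : W.IsPointwiseFinite)
    (hfin : ∀ u v, u ≤ v → ¬ HasIntervalSummand W u v) (e : Fin n × ℤ) :
    Function.Bijective (edgeMap W e) := by
  have htight := E.isTightAt_of_no_interval hn hW hfin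
  -- Tightness makes the dimension weakly decrease to the right, whichever way the edges point.
  have hmono : ∀ p x : Fin n × ℤ, position p ≤ position x →
      Module.finrank K (W.obj x) ≤ Module.finrank K (W.obj p) := by
    intro p
    refine right_induction (Q := Q) hn le_rfl ?_ ?_
    · intro e he _ ih
      have := hW (unwoundSrc Q e)
      exact (LinearMap.finrank_le_finrank_of_surjective ((htight e).1 he)).trans ih
    · intro e he _ ih
      have := hW (unwoundTgt Q e)
      exact (LinearMap.finrank_le_finrank_of_injective ((htight e).2 he)).trans ih
  have hconst : ∀ x y : Fin n × ℤ, position y ≤ position x + 1 → position x ≤ position y + 1 →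
      Module.finrank K (W.obj x) = Module.finrank K (W.obj y) := by
    have hle : ∀ x y : Fin n × ℤ, position y ≤ position x + 1 →
        Module.finrank K (W.obj x) ≤ Module.finrank K (W.obj y) := fun x y h => by
      -- The translate of `x` by one period has the same dimension and is not to the left of `y`.
      rw [E.finrank_eq (x := x) (y := (x.1, x.2 + 1)) rfl]
      refine hmono _ _ ?_
      rw [position_translate]
      omega
    exact fun x y h h' => (hle x y h).antisymm (hle y x h')
  have hc := src_tgt_cases (Q := Q) hn e
  have hdim := hconst (unwoundSrc Q e) (unwoundTgt Q e) (by omega) (by omega)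
  have := hW (unwoundSrc Q e)
  have := hW (unwoundTgt Q e)
  have hiff := LinearMap.injective_iff_surjective_of_finrank_eq_finrank hdim (f := edgeMap W e)
  by_cases h : Q.src e.1 = e.1
  · exact ⟨(htight e).2 h, hiff.1 ((htight e).2 h)⟩
  · exact ⟨hiff.2 ((htight e).1 h), (htight e).1 h⟩

end Equivariant

/-! ### Translates of a finite interval summand -/

/-- The indices of those translates of `[u, v]` by multiples of `n` which contain `q`. -/
def orbitIndex (n : ℕ) (u v q : ℤ) : Set ℤ :=
  {c | q ∈ Set.Icc (u + c * (n : ℤ)) (v + c * (n : ℤ))}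

theorem orbitIndex_finite (hn : 1 < n) (u v q : ℤ) : (orbitIndex n u v q).Finite := by
  refine Set.Finite.of_finite_image (f := fun c : ℤ => c * (n : ℤ))
    ((Set.finite_Icc (q - v) (q - u)).subset ?_) ?_
  · rintro _ ⟨c, hc, rfl⟩
    have h1 := hc.1
    have h2 := hc.2
    exact ⟨by simp only; omega, by simp only; omega⟩
  · exact fun c _ d _ h => mul_right_cancel₀ (by omega) h

namespace Equivariant

variable {W : Rep K (unwinding Q)} {w : ∀ x, W.obj x}
  {φ : ∀ x, W.obj x →ₗ[K] K} {u v : ℤ}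

theorem cotranslate_translate_eq_one (E : Equivariant W)
    (h1 : ∀ x, position x ∈ Set.Icc u v → φ x (w x) = 1) {c : ℤ} {x : Fin n × ℤ}
    (hc : c ∈ orbitIndex n u v (position x)) :
    E.cotranslate φ c x (E.translate w c x) = 1 := by
  rw [cotranslate_translate]
  exact h1 _ ((position_sub_mem_iff x c u v).2 hc)

/-- Distinct translates of a finite interval summand are independent. -/
theorem eq_zero_of_translates (E : Equivariant W) (hn : 1 < n)
    (hw : IsSection W Set.univ (Set.Icc u v) w)
    (hφ : IsCosection W Set.univ (Set.Icc u v) φ)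
    (h1 : ∀ x, position x ∈ Set.Icc u v → φ x (w x) = 1) (x : Fin n × ℤ) (g : ℤ → K)
    (I : Finset ℤ) (hI : ∀ c ∈ I, c ∈ orbitIndex n u v (position x))
    (hg : ∀ d ∈ I, E.cotranslate φ d x (∑ c ∈ I, g c • E.translate w c x) = 0) :
    ∀ c ∈ I, g c = 0 := by
  obtain ⟨e, rfl⟩ := exists_position_eq hn u
  exact eq_zero_of_sections hn e (fun c => v + c * n) I (fun _ _ => Set.subset_univ _)
    (fun c _ => E.isSection_translate hw c) (fun c _ => E.isCosection_cotranslate hφ c) x hI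
    (fun c hc => E.cotranslate_translate_eq_one h1 (hI c hc)) g hg

theorem linearIndependent_translates (E : Equivariant W) (hn : 1 < n)
    (hw : IsSection W Set.univ (Set.Icc u v) w) (hφ : IsCosection W Set.univ (Set.Icc u v) φ)
    (h1 : ∀ x, position x ∈ Set.Icc u v → φ x (w x) = 1) (x : Fin n × ℤ) :
    LinearIndependent K fun c : (orbitIndex_finite hn u v (position x)).toFinset =>
      E.translate w c x := by
  obtain ⟨e, rfl⟩ := exists_position_eq hn u
  have hf := orbitIndex_finite hn (position e) v (position x)
  exact linearIndependent_sections hn e (fun c => v + c * n) hf.toFinset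
    (fun _ _ => Set.subset_univ _)
    (fun c _ => E.isSection_translate hw c) (fun c _ => E.isCosection_cotranslate hφ c) x
    (fun c hc => hf.mem_toFinset.1 hc)
    (fun c hc => E.cotranslate_translate_eq_one h1 (hf.mem_toFinset.1 hc))

/-- The translates of a finite interval summand span spaces of the dimension of the orbit sum. -/
theorem ncard_le_finrank_span (E : Equivariant W) (hn : 1 < n) (hW : W.IsPointwiseFinite)
    (hw : IsSection W Set.univ (Set.Icc u v) w) (hφ : IsCosection W Set.univ (Set.Icc u v) φ)
    (h1 : ∀ x, position x ∈ Set.Icc u v → φ x (w x) = 1) (x : Fin n × ℤ) :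
    (orbitIndex n u v (position x)).ncard ≤
      Module.finrank K (Submodule.span K (Set.range fun c => E.translate w c x)) := by
  have hf := orbitIndex_finite hn u v (position x)
  have := hW x
  have hcard := finrank_span_eq_card (E.linearIndependent_translates hn hw hφ h1 x)
  rw [Fintype.card_coe, ← Set.ncard_eq_toFinset_card _ hf] at hcard
  rw [← hcard]
  refine Submodule.finrank_mono (Submodule.span_mono ?_)
  rintro _ ⟨c, rfl⟩
  exact ⟨c, rfl⟩

/-- One interval summand already forces the dimensions of the whole orbit sum. The classification
and the indecomposability of orbit sums both rest on this bound. -/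
theorem ncard_le_finrank (E : Equivariant W) (hn : 1 < n) (hW : W.IsPointwiseFinite)
    (h : HasIntervalSummand W u v) (x : Fin n × ℤ) :
    (orbitIndex n u v (position x)).ncard ≤ Module.finrank K (W.obj x) := by
  obtain ⟨w, φ, hw, hφ, h1⟩ := h
  have := hW x
  exact (E.ncard_le_finrank_span hn hW hw hφ h1 x).trans (Submodule.finrank_le _)

end Equivariant

end Equivariant

/-! ### Isomorphisms, periodic models and indecomposability, pointwise -/

section Category

variable {K : Type u} [Field K]

namespace Rep

variable {Γ : EdgeQuiver}

/-- A morphism of representations from linear maps that commute with the edge maps. -/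
def homOfLinear {V W : Rep K Γ} (f : ∀ x, V.obj x →ₗ[K] W.obj x)
    (h : ∀ e a, f (Γ.tgt e) ((V.map e).hom a) = (W.map e).hom (f (Γ.src e) a)) : V ⟶ W where
  app x := ModuleCat.ofHom (f x)
  comm e := ModuleCat.hom_ext (LinearMap.ext (h e))

/-- Bijective linear maps that commute with the edge maps are an isomorphism of
representations. -/
noncomputable def isoOfBijective {V W : Rep K Γ} (f : ∀ x, V.obj x →ₗ[K] W.obj x)
    (h : ∀ e a, f (Γ.tgt e) ((V.map e).hom a) = (W.map e).hom (f (Γ.src e) a))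
    (hf : ∀ x, Function.Bijective (f x)) : V ≅ W where
  hom := homOfLinear f h
  inv := homOfLinear (fun x => (LinearEquiv.ofBijective (f x) (hf x)).symm.toLinearMap)
    fun e a => by
      refine (hf _).1 ?_
      rw [h]
      have h1 := fun x b => LinearEquiv.apply_symm_apply (LinearEquiv.ofBijective (f x) (hf x)) b
      exact (h1 _ _).trans (congrArg _ (h1 _ _).symm)
  hom_inv_id := by
    ext x a
    exact LinearEquiv.symm_apply_apply (LinearEquiv.ofBijective (f x) (hf x)) a
  inv_hom_id := by
    ext x a
    exact LinearEquiv.apply_symm_apply (LinearEquiv.ofBijective (f x) (hf x)) a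

/-- The linear equivalence at a vertex given by an isomorphism of representations. -/
def isoApp {V W : Rep K Γ} (i : V ≅ W) (x : Γ.Vert) : V.obj x ≃ₗ[K] W.obj x where
  __ := (i.hom.app x).hom
  invFun := (i.inv.app x).hom
  left_inv a := by
    have := congrArg (fun f => (Hom.app f x).hom a) i.hom_inv_id
    exact this
  right_inv a := by
    have := congrArg (fun f => (Hom.app f x).hom a) i.inv_hom_id
    exact this

theorem isoApp_map {V W : Rep K Γ} (i : V ≅ W) (e : Γ.Edge) (a : V.obj (Γ.src e)) :
    isoApp i (Γ.tgt e) ((V.map e).hom a) = (W.map e).hom (isoApp i (Γ.src e) a) :=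
  congrArg (fun f => f.hom a) (i.hom.comm e)

/-- Direct sums of isomorphic representations are isomorphic. -/
noncomputable def prodIso {V V' W W' : Rep K Γ} (i : V ≅ V') (j : W ≅ W') :
    V.prod W ≅ V'.prod W' :=
  isoOfBijective (fun x => (isoApp i x).toLinearMap.prodMap (isoApp j x).toLinearMap)
    (fun e a => Prod.ext (isoApp_map i e a.1) (isoApp_map j e a.2))
    (fun x => (LinearEquiv.prodCongr (isoApp i x) (isoApp j x)).bijective)

end Rep

variable {n : ℕ} {Q : CyclicQuiver n}

theorem IsPeriodic.obj_eq {W : Rep K (unwinding Q)} (hW : IsPeriodic W) (x y : Fin n × ℤ)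
    (h : x.1 = y.1) : W.obj x = W.obj y := by
  obtain ⟨i, c⟩ := x
  obtain ⟨j, d⟩ := y
  obtain rfl : i = j := h
  have key : ∀ c : ℤ, W.obj (i, c) = W.obj (i, 0) := fun c => by
    induction c using Int.induction_on with
    | zero => rfl
    | succ k ih => rw [← hW.1, ih]
    | pred k ih => rw [← ih, hW.1 i (-k - 1), sub_add_cancel]
  rw [key c, key d]

theorem IsPeriodic.map_heq {W : Rep K (unwinding Q)} (hW : IsPeriodic W) (e e' : Fin n × ℤ)
    (h : e.1 = e'.1) : HEq (W.map e) (W.map e') := by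
  obtain ⟨i, c⟩ := e
  obtain ⟨j, d⟩ := e'
  obtain rfl : i = j := h
  have key : ∀ c : ℤ, HEq (W.map (i, c)) (W.map (i, 0)) := fun c => by
    induction c using Int.induction_on with
    | zero => rfl
    | succ k ih => exact (hW.2 i k).symm.trans ih
    | pred k ih =>
      have := hW.2 i (-k - 1)
      rw [sub_add_cancel] at this
      exact this.trans ih
  exact (key c).trans (key d).symm

theorem eqToHom_hom_comm {A A' B B' : ModuleCat.{u} K} {f : A ⟶ B} {f' : A' ⟶ B'} (hA : A = A')
    (hB : B = B') (hf : HEq f f') (a : A) :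
    (eqToHom hB).hom (f.hom a) = f'.hom ((eqToHom hA).hom a) := by
  subst hA hB
  cases hf
  rfl

/-- The translations of a periodic representation. -/
def IsPeriodic.equivariant {W : Rep K (unwinding Q)} (hW : IsPeriodic W) : Equivariant W where
  tr x y h := (eqToHom (hW.obj_eq x y h)).hom
  refl x a := by simp
  trans x y z hxy hyz hxz a := by
    rw [← eqToHom_trans (hW.obj_eq x y hxy) (hW.obj_eq y z hyz)]
    rfl
  comm e e' h hs ht a :=
    eqToHom_hom_comm (hW.obj_eq _ _ hs) (hW.obj_eq _ _ ht) (hW.map_heq e e' h) a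

namespace Equivariant

/-- The periodic representation obtained from the spaces `W_{(x_i, 0)}`. -/
def periodize {W : Rep K (unwinding Q)} (E : Equivariant W) : Rep K (unwinding Q) where
  obj x := W.obj (x.1, 0)
  map e := ModuleCat.ofHom
    ((E.tr (unwoundTgt Q e) ((unwoundTgt Q e).1, 0) rfl) ∘ₗ edgeMap W e ∘ₗ
      (E.tr ((unwoundSrc Q e).1, 0) (unwoundSrc Q e) rfl))

/-- Once `s = s'` and `t = t'` are substituted the translations are identities, so commutation with
them is equality. -/
theorem heq_of_comm {W : Rep K (unwinding Q)} (E : Equivariant W) {s s' t t' : Fin n}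
    (hs : s = s') (ht : t = t') (f : W.obj (s, 0) ⟶ W.obj (t, 0))
    (f' : W.obj (s', 0) ⟶ W.obj (t', 0))
    (h : ∀ a, E.tr (t, 0) (t', 0) ht (f.hom a) = f'.hom (E.tr (s, 0) (s', 0) hs a)) :
    HEq f f' := by
  subst hs ht
  refine heq_of_eq (ModuleCat.hom_ext (LinearMap.ext fun a => ?_))
  have := h a
  rwa [E.refl, E.refl] at this

theorem isPeriodic_periodize {W : Rep K (unwinding Q)} (E : Equivariant W) :
    IsPeriodic E.periodize := by
  refine ⟨fun _ _ => rfl, fun j c => ?_⟩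
  have hs := src_fst_congr (Q := Q) (e := (j, c)) (e' := (j, c + 1)) rfl
  have ht := tgt_fst_congr (Q := Q) (e := (j, c)) (e' := (j, c + 1)) rfl
  refine E.heq_of_comm hs ht _ _ fun a => ?_
  simp only [periodize, ModuleCat.hom_ofHom, LinearMap.comp_apply]
  have h1 := E.trans ((unwoundSrc Q (j, c)).1, 0) ((unwoundSrc Q (j, c + 1)).1, 0)
    (unwoundSrc Q (j, c + 1)) hs rfl hs a
  have h2 := E.trans ((unwoundSrc Q (j, c)).1, 0) (unwoundSrc Q (j, c))
    (unwoundSrc Q (j, c + 1)) rfl hs hs a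
  rw [h1, ← h2, ← E.comm (j, c) (j, c + 1) rfl hs ht]
  exact (E.trans (unwoundTgt Q (j, c)) ((unwoundTgt Q (j, c)).1, 0)
    ((unwoundTgt Q (j, c + 1)).1, 0) rfl ht ht _).trans
    (E.trans (unwoundTgt Q (j, c)) (unwoundTgt Q (j, c + 1))
      ((unwoundTgt Q (j, c + 1)).1, 0) ht rfl ht _).symm

/-- An equivariant representation is isomorphic to a periodic one. -/
noncomputable def isoPeriodize {W : Rep K (unwinding Q)} (E : Equivariant W) : W ≅ E.periodize :=
  Rep.isoOfBijective (fun x => E.tr x (x.1, 0) rfl)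
    (fun e a => by
      change E.tr (unwoundTgt Q e) ((unwoundTgt Q e).1, 0) rfl (edgeMap W e a) =
        E.tr (unwoundTgt Q e) ((unwoundTgt Q e).1, 0) rfl (edgeMap W e
          (E.tr ((unwoundSrc Q e).1, 0) (unwoundSrc Q e) rfl
            (E.tr (unwoundSrc Q e) ((unwoundSrc Q e).1, 0) rfl a)))
      rw [E.tr_tr_symm])
    (fun x => E.tr_bijective x (x.1, 0) rfl)

/-- An equivariant pointwise finite-dimensional representation is isomorphic to an object of
`PRep`. -/
theorem exists_iso {W : Rep K (unwinding Q)} (E : Equivariant W) (hW : W.IsPointwiseFinite) :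
    ∃ P : PRep K Q, Nonempty (W ≅ P.obj) :=
  ⟨⟨E.periodize, fun x => hW (x.1, 0), E.isPeriodic_periodize⟩, ⟨E.isoPeriodize⟩⟩

end Equivariant

/-- The biproduct in `PRep` is the pointwise direct sum. -/
theorem nonempty_biprod_iso (Y Z : PRep K Q) : Nonempty (Y ⊞ Z ≅ (prodBicone Y Z).pt) := by
  have h : (prodBicone Y Z).IsBilimit := isBinaryBilimitOfTotal _ (by
    ext1
    refine Rep.hom_ext fun x => ModuleCat.hom_ext (LinearMap.ext fun p => ?_)
    obtain ⟨a, b⟩ := p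
    exact Prod.ext (add_zero a) (zero_add b))
  exact ⟨(biprod.uniqueUpToIso Y Z h).symm⟩

theorem isZero_iff (Y : PRep K Q) : IsZero Y ↔ ∀ x, Subsingleton (Y.obj.obj x) := by
  rw [IsZero.iff_id_eq_zero]
  constructor
  · refine fun h x => ⟨fun a b => ?_⟩
    have key : ∀ a : Y.obj.obj x, a = 0 := fun a =>
      congrArg (fun f : Y ⟶ Y => (Rep.Hom.app f.hom x).hom a) h
    rw [key a, key b]
  · intro h
    ext1
    refine Rep.hom_ext fun x => ModuleCat.hom_ext (LinearMap.ext fun p => ?_)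
    have := h x
    exact Subsingleton.elim (α := Y.obj.obj x) _ _

/-- Indecomposability in terms of pointwise direct sums. -/
theorem indecomposable_iff (W : PRep K Q) : Indecomposable W ↔
    (∃ x, Nontrivial (W.obj.obj x)) ∧ ∀ Y Z : PRep K Q, Nonempty (W.obj ≅ Y.obj.prod Z.obj) →
      (∀ x, Subsingleton (Y.obj.obj x)) ∨ ∀ x, Subsingleton (Z.obj.obj x) := by
  rw [Indecomposable, isZero_iff]
  push Not
  refine and_congr Iff.rfl (forall₂_congr fun Y Z => ?_)
  rw [isZero_iff, isZero_iff]
  obtain ⟨i⟩ := nonempty_biprod_iso Y Z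
  constructor
  · rintro h ⟨j⟩
    exact h ((periodicFinite K Q).isoMk j ≪≫ i.symm)
  · exact fun h j => h ⟨(periodicFinite K Q).ι.mapIso (j ≪≫ i)⟩

/-! ### Complementary subrepresentations stable under translation -/

section Subrepresentation

variable (W : Rep K (unwinding Q)) (S : ∀ x, Submodule K (W.obj x))

/-- The subrepresentation on a family of subspaces stable under the edge maps. -/
def subRep (hS : ∀ e, ∀ a ∈ S (unwoundSrc Q e), edgeMap W e a ∈ S (unwoundTgt Q e)) :
    Rep K (unwinding Q) where
  obj x := ModuleCat.of K (S x)
  map e := ModuleCat.ofHom ((edgeMap W e).restrict (hS e))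

variable {W S}

/-- A subrepresentation stable under the translations is equivariant. -/
def Equivariant.subRep (E : Equivariant W)
    (hS : ∀ e, ∀ a ∈ S (unwoundSrc Q e), edgeMap W e a ∈ S (unwoundTgt Q e))
    (hE : ∀ x y h, ∀ a ∈ S x, E.tr x y h a ∈ S y) : Equivariant (subRep W S hS) where
  tr x y h := (E.tr x y h).restrict (hE x y h)
  refl x a := Subtype.ext (E.refl x a.1)
  trans x y z h1 h2 h3 a := Subtype.ext (E.trans x y z h1 h2 h3 a.1)
  comm e e' h hs ht a := Subtype.ext (E.comm e e' h hs ht a.1)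

/-- In an indecomposable object, one of two complementary equivariant subrepresentations is
zero. -/
theorem eq_bot_or_eq_bot {W : PRep K Q} (hW : Indecomposable W) (E : Equivariant W.obj)
    {S N : ∀ x, Submodule K (W.obj.obj x)} (hc : ∀ x, IsCompl (S x) (N x))
    (hS : ∀ e, ∀ a ∈ S (unwoundSrc Q e), edgeMap W.obj e a ∈ S (unwoundTgt Q e))
    (hN : ∀ e, ∀ a ∈ N (unwoundSrc Q e), edgeMap W.obj e a ∈ N (unwoundTgt Q e))
    (hSE : ∀ x y h, ∀ a ∈ S x, E.tr x y h a ∈ S y)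
    (hNE : ∀ x y h, ∀ a ∈ N x, E.tr x y h a ∈ N y) : (∀ x, S x = ⊥) ∨ ∀ x, N x = ⊥ := by
  have hfin := W.property.1
  obtain ⟨Y, ⟨i⟩⟩ := (E.subRep hS hSE).exists_iso (fun x => by
    have := hfin x
    exact inferInstanceAs (FiniteDimensional K (S x)))
  obtain ⟨Z, ⟨j⟩⟩ := (E.subRep hN hNE).exists_iso (fun x => by
    have := hfin x
    exact inferInstanceAs (FiniteDimensional K (N x)))
  let f : (subRep W.obj S hS).prod (subRep W.obj N hN) ≅ W.obj :=
    Rep.isoOfBijective (fun x => (Submodule.prodEquivOfIsCompl _ _ (hc x)).toLinearMap)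
      (fun e a => (map_add (edgeMap W.obj e) _ _).symm)
      (fun x => (Submodule.prodEquivOfIsCompl _ _ (hc x)).bijective)
  rcases ((indecomposable_iff W).1 hW).2 Y Z ⟨f.symm ≪≫ Rep.prodIso i j⟩ with h | h
  · exact Or.inl fun x => have := h x
      Submodule.subsingleton_iff_eq_bot.1 (Rep.isoApp i x).toEquiv.subsingleton
  · exact Or.inr fun x => have := h x
      Submodule.subsingleton_iff_eq_bot.1 (Rep.isoApp j x).toEquiv.subsingleton

end Subrepresentation

end Category

/-! ### A model of the orbit sum by functions of the translation index -/

section OrbitModel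

variable {K : Type u} [Field K]

/-- The functions on the integers that vanish outside of `I`. -/
def supportedOn (K : Type u) [Field K] (I : Set ℤ) : Submodule K (ℤ → K) where
  carrier := {f | ∀ c ∉ I, f c = 0}
  add_mem' hf hg c hc := by simp [hf c hc, hg c hc]
  zero_mem' _ _ := rfl
  smul_mem' r f hf c hc := by simp [hf c hc]

open Classical in
/-- Functions on `I` are the same as functions supported on `I`. -/
noncomputable def supportedOnEquiv (I : Set ℤ) : supportedOn K I ≃ₗ[K] (I → K) where
  toFun f c := f.1 c
  map_add' _ _ := rfl
  map_smul' _ _ := rfl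
  invFun g := ⟨fun c => if h : c ∈ I then g ⟨c, h⟩ else 0, fun _ hc => dif_neg hc⟩
  left_inv f := by
    ext c
    by_cases h : c ∈ I
    · simp [h]
    · simp [h, f.2 c h]
  right_inv g := by
    ext c
    simp

theorem finrank_supportedOn {I : Set ℤ} (hI : I.Finite) :
    Module.finrank K (supportedOn K I) = I.ncard := by
  have := hI.fintype
  rw [(supportedOnEquiv (K := K) I).finrank_eq, Module.finrank_fintype_fun_eq_card,
    Set.ncard_eq_toFinset_card', Set.toFinset_card]

theorem finiteDimensional_supportedOn {I : Set ℤ} (hI : I.Finite) :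
    FiniteDimensional K (supportedOn K I) := by
  have := hI.fintype
  exact (supportedOnEquiv (K := K) I).symm.finiteDimensional

open Classical in
/-- Restriction of functions to `J`. -/
noncomputable def restrictSupport (I J : Set ℤ) : supportedOn K I →ₗ[K] supportedOn K J where
  toFun f := ⟨fun c => if c ∈ J then f.1 c else 0, fun _ hc => if_neg hc⟩
  map_add' f g := by
    ext c
    by_cases h : c ∈ J <;> simp [h]
  map_smul' r f := by
    ext c
    by_cases h : c ∈ J <;> simp [h]

variable {n : ℕ}

variable (K) in
/-- A model of the orbit sum of `[u, v]`, whose vectors are functions on the integers. -/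
noncomputable def orbitModel (Q : CyclicQuiver n) (u v : ℤ) : Rep K (unwinding Q) where
  obj x := ModuleCat.of K (supportedOn K (orbitIndex n u v (position x)))
  map _ := ModuleCat.ofHom (restrictSupport _ _)

variable {Q : CyclicQuiver n} {u v : ℤ}

theorem orbitModel_isPointwiseFinite (hn : 1 < n) : (orbitModel K Q u v).IsPointwiseFinite :=
  fun x => finiteDimensional_supportedOn (orbitIndex_finite hn u v (position x))

theorem finrank_orbitModel (hn : 1 < n) (x : Fin n × ℤ) :
    Module.finrank K ((orbitModel K Q u v).obj x) = (orbitIndex n u v (position x)).ncard :=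
  finrank_supportedOn (orbitIndex_finite hn u v (position x))

/-- Moving a vertex by some number of periods moves its index set by the same number; this is why
translations of the model can act by shifting functions. -/
theorem sub_mem_orbitIndex_iff {x y : Fin n × ℤ} (h : x.1 = y.1) (c : ℤ) :
    c - (y.2 - x.2) ∈ orbitIndex n u v (position x) ↔ c ∈ orbitIndex n u v (position y) := by
  simp only [orbitIndex, Set.mem_ofPred_eq, Set.mem_Icc, position_eq_of_fst_eq h, sub_mul]
  constructor <;> rintro ⟨h1, h2⟩ <;> constructor <;> linarith

theorem src_snd_sub {e e' : Fin n × ℤ} (h : e.1 = e'.1) :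
    (unwoundSrc Q e').2 - (unwoundSrc Q e).2 = e'.2 - e.2 := by
  have := src_translate (Q := Q) e (e'.2 - e.2)
  rw [show (e.1, e.2 + (e'.2 - e.2)) = e' by ext1 <;> simp [h]] at this
  rw [this]
  ring

theorem tgt_snd_sub {e e' : Fin n × ℤ} (h : e.1 = e'.1) :
    (unwoundTgt Q e').2 - (unwoundTgt Q e).2 = e'.2 - e.2 := by
  have := tgt_translate (Q := Q) e (e'.2 - e.2)
  rw [show (e.1, e.2 + (e'.2 - e.2)) = e' by ext1 <;> simp [h]] at this
  rw [this]
  ring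

/-- The translations of the model of the orbit sum. -/
noncomputable def orbitModelEquivariant (Q : CyclicQuiver n) (u v : ℤ) :
    Equivariant (orbitModel K Q u v) where
  tr x y h :=
    { toFun := fun f => ⟨fun c => f.1 (c - (y.2 - x.2)),
        fun c hc => f.2 _ (mt (sub_mem_orbitIndex_iff h c).1 hc)⟩
      map_add' := fun _ _ => rfl
      map_smul' := fun _ _ => rfl }
  refl x f := by
    refine Subtype.ext (funext fun c => ?_)
    change f.1 (c - (x.2 - x.2)) = f.1 c
    simp
  trans x y z _ _ _ f := by
    refine Subtype.ext (funext fun c => ?_)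
    exact congrArg f.1 (by ring : c - (z.2 - y.2) - (y.2 - x.2) = c - (z.2 - x.2))
  comm e e' h hs ht f := by
    classical
    refine Subtype.ext (funext fun c => ?_)
    change (if c - ((unwoundTgt Q e').2 - (unwoundTgt Q e).2) ∈
        orbitIndex n u v (position (unwoundTgt Q e)) then
          f.1 (c - ((unwoundTgt Q e').2 - (unwoundTgt Q e).2)) else 0) =
      if c ∈ orbitIndex n u v (position (unwoundTgt Q e')) then
        f.1 (c - ((unwoundSrc Q e').2 - (unwoundSrc Q e).2)) else 0
    rw [src_snd_sub h, ← sub_mem_orbitIndex_iff ht, tgt_snd_sub h]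

theorem zero_mem_orbitIndex_iff (q : ℤ) : 0 ∈ orbitIndex n u v q ↔ q ∈ Set.Icc u v := by
  simp [orbitIndex]

/-- The summand is the one of index 0: the section is the indicator function of 0, the cosection is
evaluation at 0. -/
theorem orbitModel_hasIntervalSummand (Q : CyclicQuiver n) (u v : ℤ) :
    HasIntervalSummand (orbitModel K Q u v) u v := by
  classical
  refine ⟨fun x => ⟨fun c => if c = 0 ∧ 0 ∈ orbitIndex n u v (position x) then 1 else 0, ?_⟩,
    fun x => LinearMap.proj 0 ∘ₗ (supportedOn K (orbitIndex n u v (position x))).subtype,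
    ⟨fun x hx => ?_, fun e _ _ hs => ?_⟩, ⟨fun x hx => ?_, fun e _ _ ht f => ?_⟩, fun x hx => ?_⟩
  · intro c hc
    refine if_neg ?_
    rintro ⟨rfl, h⟩
    exact hc h
  · rw [← zero_mem_orbitIndex_iff (n := n)] at hx
    refine Subtype.ext (funext fun c => if_neg fun h => hx h.2)
  · rw [← zero_mem_orbitIndex_iff (n := n)] at hs
    refine Subtype.ext (funext fun c => ?_)
    change (if c ∈ orbitIndex n u v (position (unwoundTgt Q e)) then
      if c = 0 ∧ 0 ∈ orbitIndex n u v (position (unwoundSrc Q e)) then 1 else 0 else 0) =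
      if c = 0 ∧ 0 ∈ orbitIndex n u v (position (unwoundTgt Q e)) then (1 : K) else 0
    by_cases hc : c = 0
    · subst hc
      simp [hs]
    · simp [hc]
  · rw [← zero_mem_orbitIndex_iff (n := n)] at hx
    exact LinearMap.ext fun f => f.2 0 hx
  · rw [← zero_mem_orbitIndex_iff (n := n)] at ht
    exact if_pos ht
  · rw [← zero_mem_orbitIndex_iff (n := n)] at hx
    exact if_pos ⟨rfl, hx⟩

end OrbitModel

/-! ### Coordinates on interval representations and orbit sums -/

section IntervalCoordinates

variable {K : Type u} [Field K] {n : ℕ} {Q : CyclicQuiver n}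

theorem interval_obj_of_mem {S : Set ℤ} {x : Fin n × ℤ} (h : position x ∈ S) :
    (interval K Q S).obj x = ModuleCat.of K K := if_pos h

open Classical in
/-- The coordinate of a vector of an interval representation. -/
noncomputable def coord (Q : CyclicQuiver n) (S : Set ℤ) (x : Fin n × ℤ) :
    (interval K Q S).obj x →ₗ[K] K :=
  if h : position x ∈ S then (eqToHom (interval_obj_of_mem h)).hom else 0

theorem coord_of_mem {S : Set ℤ} {x : Fin n × ℤ} (h : position x ∈ S) :
    coord Q S x = (eqToHom (interval_obj_of_mem (K := K) h)).hom := dif_pos h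

theorem coord_of_notMem {S : Set ℤ} {x : Fin n × ℤ} (h : position x ∉ S) :
    coord (K := K) Q S x = 0 := dif_neg h

theorem eqToHom_hom_bijective {A B : ModuleCat.{u} K} (h : A = B) :
    Function.Bijective (eqToHom h).hom := by
  subst h
  exact Function.bijective_id

theorem eqToHom_hom_trans {A B C : ModuleCat.{u} K} (h : A = B) (h' : B = C) (a : A) :
    (eqToHom h').hom ((eqToHom h).hom a) = (eqToHom (h.trans h')).hom a := by
  subst h h'
  rfl

theorem coord_bijective {S : Set ℤ} {x : Fin n × ℤ} (h : position x ∈ S) :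
    Function.Bijective (coord (K := K) Q S x) := by
  rw [coord_of_mem h]
  exact eqToHom_hom_bijective _

theorem coord_injective (S : Set ℤ) (x : Fin n × ℤ) :
    Function.Injective (coord (K := K) Q S x) := by
  by_cases h : position x ∈ S
  · exact (coord_bijective h).1
  · have hx : (interval K Q S).obj x = ModuleCat.of K PUnit := if_neg h
    have : Subsingleton ((interval K Q S).obj x) := by
      rw [hx]
      exact inferInstanceAs (Subsingleton PUnit)
    exact Function.injective_of_subsingleton _

open Classical in
-- Testing the target alone suffices: if the source is outside `S`, its coordinate is already zero.
theorem coord_map (S : Set ℤ) (e : Fin n × ℤ) (a : (interval K Q S).obj (unwoundSrc Q e)) :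
    coord Q S (unwoundTgt Q e) (((interval K Q S).map e).hom a) =
      if position (unwoundTgt Q e) ∈ S then coord Q S (unwoundSrc Q e) a else 0 := by
  by_cases ht : position (unwoundTgt Q e) ∈ S
  · rw [if_pos ht]
    by_cases hs : position (unwoundSrc Q e) ∈ S
    · have hm : (interval K Q S).map e = eqToHom
          ((interval_obj_of_mem hs).trans (interval_obj_of_mem ht).symm) :=
        dif_pos ⟨hs, ht⟩
      rw [hm, coord_of_mem hs, coord_of_mem ht]
      exact eqToHom_hom_trans _ _ a
    · have hm : (interval K Q S).map e = 0 := dif_neg fun h => hs h.1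
      rw [hm, coord_of_notMem hs]
      exact map_zero _
  · rw [if_neg ht, coord_of_notMem ht, LinearMap.zero_apply]

/-- The coordinates of a vector of an orbit sum. -/
noncomputable def orbitSumCoord (Q : CyclicQuiver n) (u v : ℤ) (x : Fin n × ℤ) :
    (⨁ c : ℤ, (interval K Q (Set.Icc (u + c * (n : ℤ)) (v + c * (n : ℤ)))).obj x) →ₗ[K]
      supportedOn K (orbitIndex n u v (position x)) :=
  LinearMap.codRestrict _ (LinearMap.pi fun c => coord Q _ x ∘ₗ DirectSum.component K ℤ _ c)
    fun _ _ hc => LinearMap.congr_fun (coord_of_notMem hc) _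

/-- The orbit sum is isomorphic to its model. -/
theorem nonempty_orbitSum_iso (hn : 1 < n) (u v : ℤ) :
    Nonempty (orbitSum K Q u v ≅ orbitModel K Q u v) := by
  classical
  refine ⟨Rep.isoOfBijective (fun x => orbitSumCoord Q u v x)
    (fun e a => Subtype.ext (funext fun c => ?_)) fun x => ⟨fun a b hab => ?_, fun f => ?_⟩⟩
  · exact coord_map _ e (DirectSum.component K ℤ _ c a)
  · refine DFinsupp.ext fun c => coord_injective _ _ ?_
    exact congrFun (congrArg Subtype.val hab) c
  · have hf := orbitIndex_finite hn u v (position x)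
    have hb : ∀ c : ℤ, ∃ b : (interval K Q (Set.Icc (u + c * (n : ℤ)) (v + c * (n : ℤ)))).obj x,
        coord Q _ x b = f.1 c := by
      intro c
      by_cases hc : position x ∈ Set.Icc (u + c * (n : ℤ)) (v + c * (n : ℤ))
      · exact (coord_bijective hc).2 _
      · exact ⟨0, by rw [map_zero]; exact (f.2 c hc).symm⟩
    choose b hb using hb
    -- Only finitely many translates contain the vertex, so the chosen coordinates form an element
    -- of the direct sum.
    let a : ⨁ c : ℤ, (interval K Q (Set.Icc (u + c * (n : ℤ)) (v + c * (n : ℤ)))).obj x :=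
      DFinsupp.mk hf.toFinset fun c => b c
    refine ⟨a, Subtype.ext (funext fun c => ?_)⟩
    change coord Q _ x (a c) = f.1 c
    have ha : a c = if c ∈ hf.toFinset then b c else 0 := DFinsupp.mk_apply
    rw [ha]
    split_ifs with hc
    · exact hb c
    · rw [map_zero]
      exact (f.2 c fun h => hc (hf.mem_toFinset.2 h)).symm

end IntervalCoordinates

/-! ### Representations with bijective maps are constant -/

section Constant

variable {K : Type u} [Field K] {n : ℕ} {Q : CyclicQuiver n}

variable (Q) in
/-- The representation with the same space at all vertices and identity maps along all edges. -/
def constRep (M : ModuleCat.{u} K) : Rep K (unwinding Q) where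
  obj _ := M
  map _ := 𝟙 M

variable (Q) in
/-- The constant representation of a finite-dimensional space, as an object of `PRep`. -/
def constPRep (M : ModuleCat.{u} K) [hM : FiniteDimensional K M] : PRep K Q :=
  ⟨constRep Q M, fun _ => hM, fun _ _ => rfl, fun _ _ => HEq.rfl⟩

theorem nonempty_interval_univ_iso (M : ModuleCat.{u} K) (l : M ≃ₗ[K] K) :
    Nonempty (interval K Q Set.univ ≅ constRep Q M) := by
  classical
  refine ⟨Rep.isoOfBijective (fun x => l.symm.toLinearMap ∘ₗ coord Q Set.univ x)
    (fun e a => ?_) fun x => l.symm.bijective.comp (coord_bijective trivial)⟩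
  have := coord_map Set.univ e a
  rw [if_pos (Set.mem_univ _)] at this
  exact congrArg l.symm this

/-- The compatible families of vectors. -/
def globalSections (W : Rep K (unwinding Q)) : Submodule K (∀ x, W.obj x) where
  carrier := {w | ∀ e, edgeMap W e (w (unwoundSrc Q e)) = w (unwoundTgt Q e)}
  add_mem' := fun {w w'} hw hw' e => by
    change edgeMap W e (w _ + w' _) = w _ + w' _
    rw [map_add, hw e, hw' e]
  zero_mem' := fun e => map_zero _
  smul_mem' := fun r w hw e => by
    change edgeMap W e (r • w _) = r • w _
    rw [map_smul, hw e]

/-- The value of a compatible family of vectors at a vertex. -/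
def evalAt (W : Rep K (unwinding Q)) (x : Fin n × ℤ) : globalSections W →ₗ[K] W.obj x :=
  LinearMap.proj x ∘ₗ (globalSections W).subtype

/-- A sequence indexed by the integers in which consecutive terms are related. -/
theorem exists_int_sequence {A : ℤ → Type*} (R : ∀ q, A q → A (q + 1) → Prop)
    (hr : ∀ q a, ∃ b, R q a b) (hl : ∀ q b, ∃ a, R q a b) (a₀ : A 0) :
    ∃ f : ∀ q, A q, f 0 = a₀ ∧ ∀ q, R q (f q) (f (q + 1)) := by
  choose s hs using hr
  choose p hp using hl
  let f₁ : ∀ k : ℕ, A (Int.ofNat k) := fun k => Nat.rec a₀ (fun k a => s (Int.ofNat k) a) k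
  let f₂ : ∀ k : ℕ, A (Int.negSucc k) := fun k =>
    Nat.rec (p (Int.negSucc 0) a₀) (fun k a => p (Int.negSucc (k + 1)) a) k
  let f : ∀ q : ℤ, A q := fun q => Int.rec f₁ f₂ q
  refine ⟨f, rfl, fun q => ?_⟩
  match q with
  | Int.ofNat k => exact hs (Int.ofNat k) (f₁ k)
  | Int.negSucc 0 => exact hp (Int.negSucc 0) a₀
  | Int.negSucc (k + 1) => exact hp (Int.negSucc (k + 1)) (f₂ k)

/-- Only the values at the two ends of `e` matter. Carrying them in a family over all vertices gives
one statement for both directions of the edge. -/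
theorem exists_section_at_edge (hn : 1 < n) {W : Rep K (unwinding Q)} {e : Fin n × ℤ}
    (he : Function.Bijective (edgeMap W e)) {y : Fin n × ℤ}
    (hy : y = unwoundSrc Q e ∨ y = unwoundTgt Q e) (a : W.obj y) :
    ∃ w : ∀ x, W.obj x, w y = a ∧ edgeMap W e (w (unwoundSrc Q e)) = w (unwoundTgt Q e) := by
  have hne : unwoundSrc Q e ≠ unwoundTgt Q e := fun h => by
    have := src_tgt_cases (Q := Q) hn e
    rw [h] at this
    omega
  rcases hy with rfl | rfl
  · refine ⟨Function.update (Function.update (fun _ => 0) _ a) (unwoundTgt Q e) (edgeMap W e a),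
      ?_, ?_⟩
    · rw [Function.update_of_ne hne, Function.update_self]
    · rw [Function.update_of_ne hne, Function.update_self, Function.update_self]
  · obtain ⟨b, rfl⟩ := he.2 a
    refine ⟨Function.update (Function.update (fun _ => 0) _ b) (unwoundTgt Q e) (edgeMap W e b),
      ?_, ?_⟩
    · rw [Function.update_self]
    · rw [Function.update_of_ne hne, Function.update_self, Function.update_self]

/-- If all maps are bijective, then every vector extends uniquely to a compatible family. -/
theorem evalAt_bijective (hn : 1 < n) {W : Rep K (unwinding Q)}
    (hW : ∀ e, Function.Bijective (edgeMap W e)) (x : Fin n × ℤ) :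
    Function.Bijective (evalAt W x) := by
  have hpos : Function.Bijective (position (n := n)) :=
    ⟨fun _ _ => position_inj, exists_position_eq hn⟩
  let vx : ℤ ≃ Fin n × ℤ := (Equiv.ofBijective _ hpos).symm
  have hvx : ∀ q, position (vx q) = q := Equiv.apply_symm_apply (Equiv.ofBijective _ hpos)
  have hends : ∀ q : ℤ, ∀ e, position e = q + 1 →
      (unwoundSrc Q e = vx q ∧ unwoundTgt Q e = vx (q + 1)) ∨
        (unwoundSrc Q e = vx (q + 1) ∧ unwoundTgt Q e = vx q) := by
    intro q e he
    have h1 := hvx q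
    have h2 := hvx (q + 1)
    rcases src_tgt_cases (Q := Q) hn e with h | h
    · exact Or.inl ⟨position_inj (by omega), position_inj (by omega)⟩
    · exact Or.inr ⟨position_inj (by omega), position_inj (by omega)⟩
  -- Evaluations at the two ends of an edge differ by its bijective map, so a single vertex
  -- suffices. There, uniqueness spreads along the line and existence comes from a two-sided
  -- recursion.
  refine line_induction (Q := Q) hn (P := fun x => Function.Bijective (evalAt W x)) (p := vx 0)
    ⟨?_, fun a => ?_⟩ (fun e => ?_) x
  · rw [← LinearMap.ker_eq_bot, LinearMap.ker_eq_bot']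
    intro w hw
    refine Subtype.ext (funext fun y => ?_)
    refine line_induction (Q := Q) hn (P := fun y => w.1 y = 0) (p := vx 0) hw (fun e => ?_) y
    rw [← w.2 e]
    exact ((map_eq_zero_iff _ (hW e).1)).symm
  · obtain ⟨f, hf0, hf⟩ := exists_int_sequence (A := fun q => W.obj (vx q))
      (fun q a b => ∃ w : ∀ x, W.obj x, w (vx q) = a ∧ w (vx (q + 1)) = b ∧
        ∀ e, position e = q + 1 → edgeMap W e (w (unwoundSrc Q e)) = w (unwoundTgt Q e))
      (fun q a => by
        have he := hends q _ (hvx (q + 1))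
        obtain ⟨w, h1, h2⟩ := exists_section_at_edge (W := W) hn (hW (vx (q + 1))) (y := vx q)
          (by rcases he with h | h <;> simp [h.1, h.2]) a
        refine ⟨_, w, h1, rfl, fun e h => ?_⟩
        obtain rfl : e = vx (q + 1) := position_inj (h.trans (hvx _).symm)
        exact h2)
      (fun q a => by
        have he := hends q _ (hvx (q + 1))
        obtain ⟨w, h1, h2⟩ := exists_section_at_edge (W := W) hn (hW (vx (q + 1)))
          (y := vx (q + 1)) (by rcases he with h | h <;> simp [h.1, h.2]) a
        refine ⟨_, w, rfl, h1, fun e h => ?_⟩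
        obtain rfl : e = vx (q + 1) := position_inj (h.trans (hvx _).symm)
        exact h2) a
    have hw : ∀ q, Equiv.piCongrLeft (fun x => W.obj x) vx f (vx q) = f q :=
      Equiv.piCongrLeft_apply_apply (fun x => W.obj x) vx f
    refine ⟨⟨Equiv.piCongrLeft (fun x => W.obj x) vx f, fun e => ?_⟩, (hw 0).trans hf0⟩
    obtain ⟨w, h1, h2, h3⟩ := hf (position e - 1)
    rw [← hw] at h1 h2
    have h4 := h3 e (by omega)
    rcases hends (position e - 1) e (by omega) with h | h
    · rw [← h.1] at h1
      rw [← h.2] at h2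
      rwa [h1, h2] at h4
    · rw [← h.1] at h2
      rw [← h.2] at h1
      rwa [h1, h2] at h4
  · have : ⇑(evalAt W (unwoundTgt Q e)) = edgeMap W e ∘ evalAt W (unwoundSrc Q e) :=
      funext fun w => (w.2 e).symm
    rw [this, (hW e).of_comp_iff']

/-- A representation with bijective maps is constant. -/
theorem nonempty_iso_const (hn : 1 < n) {W : Rep K (unwinding Q)}
    (hW : ∀ e, Function.Bijective (edgeMap W e)) :
    Nonempty (constRep Q (ModuleCat.of K (globalSections W)) ≅ W) :=
  ⟨Rep.isoOfBijective (evalAt W) (fun e w => (w.2 e).symm) (evalAt_bijective hn hW)⟩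

end Constant

/-! ### Recognising and verifying the indecomposables -/

section Classification

variable {K : Type u} [Field K] {n : ℕ} {Q : CyclicQuiver n} {u v : ℤ}

theorem indecomposable_congr {W W' : PRep K Q} (i : W.obj ≅ W'.obj) (hW : Indecomposable W) :
    Indecomposable W' := by
  rw [indecomposable_iff] at hW ⊢
  obtain ⟨⟨x, hx⟩, h⟩ := hW
  exact ⟨⟨x, (Rep.isoApp i x).symm.toEquiv.nontrivial⟩, fun Y Z ⟨j⟩ => h Y Z ⟨i ≪≫ j⟩⟩

/-- The cosections given by the translates of `φ`, as maps to the model of the orbit sum. -/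
def Equivariant.toOrbitModel {W : Rep K (unwinding Q)} (E : Equivariant W)
    {φ : ∀ x, W.obj x →ₗ[K] K} (hφ : IsCosection W Set.univ (Set.Icc u v) φ) (x : Fin n × ℤ) :
    W.obj x →ₗ[K] supportedOn K (orbitIndex n u v (position x)) :=
  LinearMap.codRestrict _ (LinearMap.pi fun c => E.cotranslate φ c x)
    fun _ c hc => LinearMap.congr_fun ((E.isCosection_cotranslate hφ c).eq_zero x hc) _

theorem Equivariant.toOrbitModel_map {W : Rep K (unwinding Q)} (E : Equivariant W)
    {φ : ∀ x, W.obj x →ₗ[K] K} (hφ : IsCosection W Set.univ (Set.Icc u v) φ) (e : Fin n × ℤ)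
    (a : W.obj (unwoundSrc Q e)) : E.toOrbitModel hφ (unwoundTgt Q e) (edgeMap W e a) =
      edgeMap (orbitModel K Q u v) e (E.toOrbitModel hφ (unwoundSrc Q e) a) := by
  classical
  refine Subtype.ext (funext fun c => ?_)
  change E.cotranslate φ c _ (edgeMap W e a) =
    if c ∈ orbitIndex n u v (position (unwoundTgt Q e)) then E.cotranslate φ c _ a else 0
  split_ifs with hc
  · exact (E.isCosection_cotranslate hφ c).map_eq e trivial trivial hc a
  · rw [(E.isCosection_cotranslate hφ c).eq_zero _ hc, LinearMap.zero_apply]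

theorem Equivariant.mem_ker_toOrbitModel {W : Rep K (unwinding Q)} (E : Equivariant W)
    {φ : ∀ x, W.obj x →ₗ[K] K} (hφ : IsCosection W Set.univ (Set.Icc u v) φ) {x : Fin n × ℤ}
    {a : W.obj x} : a ∈ LinearMap.ker (E.toOrbitModel hφ x) ↔ ∀ c, E.cotranslate φ c x a = 0 :=
  ⟨fun h c => congrFun (congrArg Subtype.val h) c, fun h => Subtype.ext (funext h)⟩

/-- The sum of the translates of a finite interval summand is a direct summand. -/
theorem Equivariant.isCompl_span_ker {W : Rep K (unwinding Q)} (E : Equivariant W) (hn : 1 < n)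
    (hW : W.IsPointwiseFinite) {w : ∀ x, W.obj x} {φ : ∀ x, W.obj x →ₗ[K] K}
    (hw : IsSection W Set.univ (Set.Icc u v) w) (hφ : IsCosection W Set.univ (Set.Icc u v) φ)
    (h1 : ∀ x, position x ∈ Set.Icc u v → φ x (w x) = 1) (x : Fin n × ℤ) :
    IsCompl (Submodule.span K (Set.range fun c => E.translate w c x))
      (LinearMap.ker (E.toOrbitModel hφ x)) := by
  classical
  have hd : Disjoint (Submodule.span K (Set.range fun c => E.translate w c x))
      (LinearMap.ker (E.toOrbitModel hφ x)) := by
    rw [Submodule.disjoint_def]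
    intro a ha hk
    rw [E.mem_ker_toOrbitModel hφ] at hk
    obtain ⟨g, rfl⟩ := Finsupp.mem_span_range_iff_exists_finsupp.1 ha
    -- Translates whose interval misses `x` vanish at `x`, so only indices in the orbit index set
    -- contribute and triangularity applies.
    have hsum : (g.sum fun c r => r • E.translate w c x) =
        ∑ c ∈ g.support.filter fun c => c ∈ orbitIndex n u v (position x),
          g c • E.translate w c x := by
      rw [Finset.sum_filter]
      refine Finset.sum_congr rfl fun c _ => ?_
      split_ifs with hc
      · rfl
      · change g c • E.translate w c x = 0
        rw [(E.isSection_translate hw c).eq_zero x hc, smul_zero]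
    rw [hsum] at hk ⊢
    refine Finset.sum_eq_zero fun c hc => ?_
    rw [E.eq_zero_of_translates hn hw hφ h1 x g _ (fun c hc => (Finset.mem_filter.1 hc).2)
      (fun d _ => hk d) c hc, zero_smul]
  have := hW x
  have := finiteDimensional_supportedOn (K := K) (orbitIndex_finite hn u v (position x))
  refine ⟨hd, codisjoint_iff.2 (Submodule.eq_top_of_disjoint _ _ ?_ hd)⟩
  -- The rank is at most the dimension of the model, which is at most that of the span; so span and
  -- kernel together fill the space.
  rw [← LinearMap.finrank_range_add_finrank_ker (E.toOrbitModel hφ x)]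
  refine Nat.add_le_add_right ?_ _
  refine (Submodule.finrank_le _).trans ?_
  rw [finrank_supportedOn (orbitIndex_finite hn u v (position x))]
  exact E.ncard_le_finrank_span hn hW hw hφ h1 x

/-- An indecomposable object with a finite interval summand is an orbit sum. -/
theorem nonempty_iso_orbitModel (hn : 1 < n) {W : PRep K Q} (hW : Indecomposable W) (huv : u ≤ v)
    (h : HasIntervalSummand W.obj u v) : Nonempty (W.obj ≅ orbitModel K Q u v) := by
  obtain ⟨w, φ, hw, hφ, h1⟩ := h
  have hfin := W.property.1
  let E : Equivariant W.obj := W.property.2.equivariant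
  have hc := E.isCompl_span_ker hn hfin hw hφ h1
  have hker : ∀ x, LinearMap.ker (E.toOrbitModel hφ x) = ⊥ := by
    -- Span and kernel are equivariant subrepresentations, so one of them is zero. It is not the
    -- span: at position `u` the vector of `w` pairs to 1 with `φ`.
    refine (eq_bot_or_eq_bot hW E hc (fun e a ha => ?_) (fun e a ha => ?_) (fun x y h a ha => ?_)
      (fun x y h a ha => ?_)).resolve_left fun hbot => ?_
    · refine (Submodule.span_le (p := (Submodule.span K (Set.range fun c =>
        E.translate w c (unwoundTgt Q e))).comap (edgeMap W.obj e))).2 ?_ ha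
      rintro _ ⟨c, rfl⟩
      have hs := E.isSection_translate hw c
      change edgeMap W.obj e (E.translate w c (unwoundSrc Q e)) ∈ Submodule.span K _
      by_cases hmem : position (unwoundSrc Q e) ∈ Set.Icc (u + c * (n : ℤ)) (v + c * n)
      · rw [hs.map_eq e trivial trivial hmem]
        exact Submodule.subset_span ⟨c, rfl⟩
      · rw [hs.eq_zero _ hmem, map_zero]
        exact zero_mem _
    · have hmap := E.toOrbitModel_map hφ e a
      rw [LinearMap.mem_ker.1 ha] at hmap
      exact hmap.trans (map_zero (edgeMap (orbitModel K Q u v) e))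
    · refine (Submodule.span_le (p := (Submodule.span K (Set.range fun c =>
        E.translate w c y)).comap (E.tr x y h))).2 ?_ ha
      rintro _ ⟨c, rfl⟩
      rw [SetLike.mem_coe, Submodule.mem_comap, E.tr_translate w c h]
      exact Submodule.subset_span ⟨_, rfl⟩
    · rw [E.mem_ker_toOrbitModel hφ] at ha ⊢
      intro c
      rw [E.cotranslate_tr]
      exact ha _
    · obtain ⟨x, hx⟩ := exists_position_eq hn u
      have h0 : (0 : ℤ) ∈ orbitIndex n u v (position x) := by
        rw [zero_mem_orbitIndex_iff, hx]
        exact ⟨le_rfl, huv⟩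
      have hz : E.translate w 0 x = 0 := by
        rw [← Submodule.mem_bot K, ← hbot x]
        exact Submodule.subset_span ⟨0, rfl⟩
      have := E.cotranslate_translate_eq_one h1 h0
      rw [hz, map_zero] at this
      exact zero_ne_one this
  refine ⟨Rep.isoOfBijective (fun x => E.toOrbitModel hφ x) (E.toOrbitModel_map hφ) fun x => ?_⟩
  have hinj := LinearMap.ker_eq_bot.1 (hker x)
  have := hfin x
  have := finiteDimensional_supportedOn (K := K) (orbitIndex_finite hn u v (position x))
  have hle := LinearMap.finrank_le_finrank_of_injective hinj
  have hge := E.ncard_le_finrank hn hfin ⟨w, φ, hw, hφ, h1⟩ x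
  rw [← finrank_supportedOn (K := K) (orbitIndex_finite hn u v (position x))] at hge
  exact ⟨hinj, (LinearMap.injective_iff_surjective_of_finrank_eq_finrank (hle.antisymm hge)).1 hinj⟩

/-- An indecomposable constant object is one-dimensional. -/
theorem nonempty_equiv_of_indecomposable_const {M : ModuleCat.{u} K}
    [FiniteDimensional K M] (hM : Indecomposable (constPRep Q M)) : Nonempty (M ≃ₗ[K] K) := by
  obtain ⟨⟨x, hx⟩, -⟩ := (indecomposable_iff _).1 hM
  have hx' : Nontrivial M := hx
  obtain ⟨a, ha⟩ := exists_ne (0 : M)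
  obtain ⟨C, hC⟩ := Submodule.exists_isCompl (Submodule.span K {a})
  let E : Equivariant (constRep Q M) :=
    { tr := fun _ _ _ => LinearMap.id
      refl := fun _ _ => rfl
      trans := fun _ _ _ _ _ _ _ => rfl
      comm := fun _ _ _ _ _ _ => rfl }
  -- The same line and the same complement at every vertex split the constant representation.
  have hbot := (eq_bot_or_eq_bot hM E (S := fun _ => Submodule.span K {a}) (N := fun _ => C)
    (fun _ => hC) (fun _ _ h => h) (fun _ _ h => h) (fun _ _ _ _ h => h)
    (fun _ _ _ _ h => h)).resolve_left (fun h => ha (Submodule.span_singleton_eq_bot.1 (h x))) x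
  have htop : Submodule.span K {a} = ⊤ := by
    have := hC.sup_eq_top
    rwa [show C = ⊥ from hbot, sup_bot_eq] at this
  exact ⟨((LinearEquiv.toSpanNonzeroSingleton K M a ha).trans
    (LinearEquiv.ofTop _ htop)).symm⟩

/-- An indecomposable object without finite interval summands is the representation of the whole
line. -/
theorem nonempty_iso_interval_univ (hn : 1 < n) {W : PRep K Q} (hW : Indecomposable W)
    (hfin : ∀ u v, u ≤ v → ¬ HasIntervalSummand W.obj u v) :
    Nonempty (W.obj ≅ interval K Q Set.univ) := by
  have hbij := W.property.2.equivariant.bijective_of_no_interval hn W.property.1 hfin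
  obtain ⟨i⟩ := nonempty_iso_const hn hbij
  obtain ⟨x, -⟩ := exists_position_eq hn 0
  have := W.property.1 x
  have : FiniteDimensional K (ModuleCat.of K (globalSections W.obj)) :=
    (Rep.isoApp i x).symm.finiteDimensional
  obtain ⟨l⟩ := nonempty_equiv_of_indecomposable_const
    (indecomposable_congr (W' := constPRep Q _) i.symm hW)
  obtain ⟨j⟩ := nonempty_interval_univ_iso (Q := Q) _ l
  exact ⟨i.symm ≪≫ j.symm⟩

/-- The constant one-dimensional object is indecomposable. -/
theorem indecomposable_const (hn : 1 < n) :
    Indecomposable (constPRep Q (ModuleCat.of K K)) := by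
  rw [indecomposable_iff]
  obtain ⟨x₀, -⟩ := exists_position_eq hn 0
  refine ⟨⟨x₀, inferInstanceAs (Nontrivial K)⟩, fun Y Z ⟨i⟩ => ?_⟩
  have hprod : ∀ e, Function.Bijective ((edgeMap Y.obj e).prodMap (edgeMap Z.obj e)) := fun e => by
    have h := fun a => Rep.isoApp_map i e a
    have hcomp : ⇑((edgeMap Y.obj e).prodMap (edgeMap Z.obj e)) ∘
        ⇑(Rep.isoApp i (unwoundSrc Q e)) = Rep.isoApp i (unwoundTgt Q e) :=
      funext fun a => (h a).symm
    refine (Function.Bijective.of_comp_iff _ (Rep.isoApp i (unwoundSrc Q e)).bijective).1 ?_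
    exact (congrArg Function.Bijective hcomp).mpr (Rep.isoApp i (unwoundTgt Q e)).bijective
  have hY : ∀ e, Function.Bijective (edgeMap Y.obj e) := fun e =>
    ⟨fun a b hab => congrArg Prod.fst ((hprod e).1 (a₁ := (a, 0)) (a₂ := (b, 0))
      (Prod.ext hab rfl)), fun b => by
        obtain ⟨p, hp⟩ := (hprod e).2 (b, 0)
        exact ⟨p.1, congrArg Prod.fst hp⟩⟩
  have hZ : ∀ e, Function.Bijective (edgeMap Z.obj e) := fun e =>
    ⟨fun a b hab => congrArg Prod.snd ((hprod e).1 (a₁ := (0, a)) (a₂ := (0, b))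
      (Prod.ext rfl hab)), fun b => by
        obtain ⟨p, hp⟩ := (hprod e).2 (0, b)
        exact ⟨p.2, congrArg Prod.snd hp⟩⟩
  -- The summands inherit bijective maps, so one that vanishes at `x₀` vanishes everywhere; at `x₀`
  -- the two dimensions add up to 1.
  have hall : ∀ V : PRep K Q, (∀ e, Function.Bijective (edgeMap V.obj e)) →
      Subsingleton (V.obj.obj x₀) → ∀ x, Subsingleton (V.obj.obj x) := fun V hV h0 =>
    line_induction (Q := Q) (P := fun x => Subsingleton (V.obj.obj x)) hn h0
      fun e => (Equiv.ofBijective _ (hV e)).subsingleton_congr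
  by_cases h : Subsingleton (Y.obj.obj x₀)
  · exact Or.inl (hall Y hY h)
  · refine Or.inr (hall Z hZ ?_)
    have hfY := Y.property.1 x₀
    have hfZ := Z.property.1 x₀
    have hdim : Module.finrank K K = Module.finrank K (Y.obj.obj x₀ × Z.obj.obj x₀) :=
      (Rep.isoApp i x₀).finrank_eq
    rw [Module.finrank_self, Module.finrank_prod] at hdim
    rw [not_subsingleton_iff_nontrivial, ← Module.finrank_pos_iff (R := K)] at h
    rw [← Module.finrank_zero_iff (R := K)]
    omega

/-- An interval summand of `V` whose composite with an endomorphism factoring through `Y` does not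
vanish is an interval summand of `Y`. -/
theorem hasIntervalSummand_of_factor (hn : 1 < n) {V Y : Rep K (unwinding Q)} {w : ∀ x, V.obj x}
    {φ : ∀ x, V.obj x →ₗ[K] K} (hw : IsSection V Set.univ (Set.Icc u v) w)
    (hφ : IsCosection V Set.univ (Set.Icc u v) φ) (f : ∀ x, V.obj x →ₗ[K] Y.obj x)
    (g : ∀ x, Y.obj x →ₗ[K] V.obj x)
    (hf : ∀ e a, f (unwoundTgt Q e) (edgeMap V e a) = edgeMap Y e (f (unwoundSrc Q e) a))
    (hg : ∀ e a, g (unwoundTgt Q e) (edgeMap Y e a) = edgeMap V e (g (unwoundSrc Q e) a))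
    {x₀ : Fin n × ℤ} (hx₀ : position x₀ = u) (h : φ x₀ (g x₀ (f x₀ (w x₀))) ≠ 0) :
    HasIntervalSummand Y u v := by
  have hw' : IsSection Y Set.univ (Set.Icc u v) fun x => f x (w x) :=
    ⟨fun x hx => by rw [hw.eq_zero x hx, map_zero], fun e hs ht hsS => by
      rw [← hf, hw.map_eq e hs ht hsS]⟩
  have hφ' : IsCosection Y Set.univ (Set.Icc u v)
      fun x => (φ x₀ (g x₀ (f x₀ (w x₀))))⁻¹ • (φ x ∘ₗ g x) :=
    ⟨fun x hx => by rw [hφ.eq_zero x hx, LinearMap.zero_comp, smul_zero],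
      fun e hs ht htS a => by
        simp only [LinearMap.smul_apply, LinearMap.comp_apply]
        rw [hg, hφ.map_eq e hs ht htS]⟩
  refine ⟨_, _, hw', hφ', fun x hx => ?_⟩
  -- The pairing is constant on `[u, v]`, so normalising it at the left end suffices.
  rw [hw'.pairing_const hn (Set.subset_univ _) hφ' hx₀.ge hx₀.ge (hx₀ ▸ hx.1) hx.2 hx.2]
  simp [h]

/-- Orbit sums are indecomposable. -/
theorem indecomposable_of_iso_orbitModel (hn : 1 < n) (huv : u ≤ v) {W : PRep K Q}
    (i : W.obj ≅ orbitModel K Q u v) : Indecomposable W := by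
  rw [indecomposable_iff]
  obtain ⟨x₀, hx₀⟩ := exists_position_eq hn u
  obtain ⟨w, φ, hw, hφ, h1⟩ := orbitModel_hasIntervalSummand (K := K) Q u v
  have h10 := h1 x₀ ⟨hx₀.ge, hx₀.le.trans huv⟩
  refine ⟨⟨x₀, ?_⟩, fun Y Z ⟨j⟩ => ?_⟩
  · have : Nontrivial ((orbitModel K Q u v).obj x₀) := ⟨w x₀, 0, fun h => by
      rw [h, map_zero] at h10
      exact zero_ne_one h10⟩
    exact (Rep.isoApp i x₀).toEquiv.nontrivial
  · let k : orbitModel K Q u v ≅ Y.obj.prod Z.obj := i.symm ≪≫ j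
    have hdim : ∀ x, Module.finrank K (Y.obj.obj x) + Module.finrank K (Z.obj.obj x) =
        (orbitIndex n u v (position x)).ncard := fun x => by
      have hfY := Y.property.1 x
      have hfZ := Z.property.1 x
      rw [← finrank_orbitModel (K := K) (Q := Q) hn x, ← Module.finrank_prod]
      exact (Rep.isoApp k x).finrank_eq.symm
    -- A summand containing the interval has at least the dimensions of the orbit sum, which leaves
    -- dimension zero for the other.
    have hsub : ∀ V V' : PRep K Q, HasIntervalSummand V.obj u v →
        (∀ x, Module.finrank K (V.obj.obj x) + Module.finrank K (V'.obj.obj x) =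
          (orbitIndex n u v (position x)).ncard) → ∀ x, Subsingleton (V'.obj.obj x) := by
      intro V V' hV hd x
      have hfV := V'.property.1 x
      have := V.property.2.equivariant.ncard_le_finrank hn V.property.1 hV x
      rw [← Module.finrank_zero_iff (R := K)]
      have := hd x
      omega
    let p := fun x => (Rep.isoApp k x).toLinearMap
    let q := fun x => (Rep.isoApp k.symm x).toLinearMap
    have hqp : ∀ x a, q x (p x a) = a := fun x => (Rep.isoApp k x).symm_apply_apply
    have hp := fun e a => Rep.isoApp_map k e a
    have hq := fun e a => Rep.isoApp_map k.symm e a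
    -- The identity is the sum of the projections to `Y` and `Z`, so the pairing 1 splits into two
    -- scalars, not both zero.
    have hsum : φ x₀ (q x₀ ((p x₀ (w x₀)).1, 0)) + φ x₀ (q x₀ (0, (p x₀ (w x₀)).2)) = 1 := by
      refine (map_add (φ x₀ ∘ₗ q x₀) _ _).symm.trans ?_
      refine Eq.trans (congrArg (fun a => φ x₀ (q x₀ a)) ?_)
        ((congrArg (φ x₀) (hqp x₀ (w x₀))).trans h10)
      exact Prod.ext (add_zero _) (zero_add _)
    by_cases hY : φ x₀ (q x₀ ((p x₀ (w x₀)).1, 0)) = 0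
    · rw [hY, zero_add] at hsum
      refine Or.inl (hsub Z Y ?_ fun x => (add_comm _ _).trans (hdim x))
      refine hasIntervalSummand_of_factor hn hw hφ
        (fun x => LinearMap.snd K (Y.obj.obj x) (Z.obj.obj x) ∘ₗ p x)
        (fun x => q x ∘ₗ LinearMap.inr K (Y.obj.obj x) (Z.obj.obj x))
        (fun e a => congrArg Prod.snd (hp e a)) (fun e a => ?_) hx₀ ?_
      · refine Eq.trans (congrArg (q _) ?_) (hq e (0, a))
        exact Prod.ext (map_zero (edgeMap Y.obj e)).symm rfl
      · exact fun h => zero_ne_one (h.symm.trans hsum)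
    · refine Or.inr (hsub Y Z ?_ hdim)
      refine hasIntervalSummand_of_factor hn hw hφ
        (fun x => LinearMap.fst K (Y.obj.obj x) (Z.obj.obj x) ∘ₗ p x)
        (fun x => q x ∘ₗ LinearMap.inl K (Y.obj.obj x) (Z.obj.obj x))
        (fun e a => congrArg Prod.fst (hp e a)) (fun e a => ?_) hx₀ hY
      refine Eq.trans (congrArg (q _) ?_) (hq e (a, 0))
      exact Prod.ext rfl (map_zero (edgeMap Z.obj e)).symm

end Classification

end UnwoundQuiver

/-! ### The classification theorem -/

theorem proposition6p1 {K : Type u} [Field K] {n : ℕ} (hn : 1 < n)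
    (Q : UnwoundQuiver.CyclicQuiver n) :
    -- every indecomposable object is of one of the two kinds, and conversely
    (∀ W : UnwoundQuiver.PRep K Q, Indecomposable W ↔
      Nonempty (W.obj ≅ UnwoundQuiver.interval K Q Set.univ) ∨
        ∃ u v : ℤ, u ≤ v ∧ Nonempty (W.obj ≅ UnwoundQuiver.orbitSum K Q u v)) ∧
    -- both kinds do occur in the category, up to isomorphism
    (∃ W : UnwoundQuiver.PRep K Q, Nonempty (W.obj ≅ UnwoundQuiver.interval K Q Set.univ)) ∧
    (∀ u v : ℤ, u ≤ v →
      ∃ W : UnwoundQuiver.PRep K Q, Nonempty (W.obj ≅ UnwoundQuiver.orbitSum K Q u v)) := by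
  obtain ⟨i⟩ := UnwoundQuiver.nonempty_interval_univ_iso (Q := Q) (ModuleCat.of K K)
    (LinearEquiv.refl K K)
  refine ⟨fun W => ⟨fun hW => ?_, ?_⟩, ⟨UnwoundQuiver.constPRep Q (ModuleCat.of K K), ⟨i.symm⟩⟩,
    fun u v _ => ?_⟩
  · by_cases h : ∃ u v, u ≤ v ∧ UnwoundQuiver.HasIntervalSummand W.obj u v
    · obtain ⟨u, v, huv, h⟩ := h
      obtain ⟨j⟩ := UnwoundQuiver.nonempty_iso_orbitModel hn hW huv h
      obtain ⟨k⟩ := UnwoundQuiver.nonempty_orbitSum_iso (K := K) (Q := Q) hn u v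
      exact Or.inr ⟨u, v, huv, ⟨j ≪≫ k.symm⟩⟩
    · push Not at h
      exact Or.inl (UnwoundQuiver.nonempty_iso_interval_univ hn hW h)
  · rintro (⟨⟨j⟩⟩ | ⟨u, v, huv, ⟨j⟩⟩)
    · exact UnwoundQuiver.indecomposable_congr (j ≪≫ i).symm
        (UnwoundQuiver.indecomposable_const hn)
    · obtain ⟨k⟩ := UnwoundQuiver.nonempty_orbitSum_iso (K := K) (Q := Q) hn u v
      exact UnwoundQuiver.indecomposable_of_iso_orbitModel hn huv (j ≪≫ k)
  · obtain ⟨k⟩ := UnwoundQuiver.nonempty_orbitSum_iso (K := K) (Q := Q) hn u v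
    obtain ⟨P, ⟨j⟩⟩ := (UnwoundQuiver.orbitModelEquivariant (K := K) Q u v).exists_iso
      (UnwoundQuiver.orbitModel_isPointwiseFinite hn)
    exact ⟨P, ⟨j.symm ≪≫ k.symm⟩⟩
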